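/- The following counting problem can be solved in polynomial time: given a CNF formula $F$ whose hypergraph is $\beta$-acyclic, compute the number of satisfying assignments of $F$, that is, of assignments $a:\mathsf{var}(F)\to\{0,1\}$ under which every clause of $F$ contains a true literal. More precisely, there are a random access machine program and a polynomial $P$ such that, for every $\beta$-acyclic CNF formula $F$, the program started on an encoding of $F$ of bit length $N$ halts within time $P(N)$, measured with logarithmic cost (each operation is charged the bit length of the numbers and addresses involved), and outputs the number of satisfying assignments of $F$. Here the hypergraph of $F$ has vertex set $\mathsf{var}(F)$, the set of variables occurring in $F$, and its edges are the (non-empty) sets $\mathsf{var}(C)$ for the clauses $C$ of $F$. For a hypergraph $\mathcal H=(V,E)$ and $x\in V$, let $\mathcal H\setminus x$ be the hypergraph with vertex set $V\setminus\{x\}$ and edge set $\{e\setminus\{x\}\mid e\in E\}\setminus\{\emptyset\}$. A vertex $x$ is a nest point of $\mathcal H$ if the edges containing $x$ form a chain with respect to inclusion. A tuple $(x_1,\dots,x_n)$ is a $\beta$-elimination order of $\mathcal H$ if either $n=0$ and $V=\emptyset$, or $n\ge 1$, $x_1$ is a nest point of $\mathcal H$ and $(x_2,\dots,x_n)$ is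 a $\beta$-elimination order of $\mathcal H\setminus x_1$. The hypergraph $\mathcal H$, and likewise a formula with this hypergraph, is $\beta$-acyclic if $\mathcal H$ has a $\beta$-elimination order. -/

import Mathlib

/-! ### β-acyclic hypergraphs -/

namespace Hypergraph

variable {α : Type*}

/-- `H[S]`, the subhypergraph of `H` induced by the vertices in `S`: every edge is intersected with
`S`, and empty intersections are dropped. -/
def induce (H : Hypergraph α) (S : Set α) : Hypergraph α where
  vertexSet := H.vertexSet ∩ S
  edgeSet := {e | e.Nonempty ∧ ∃ f ∈ H.edgeSet, e = f ∩ S}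
  subset_vertexSet_of_mem_edgeSet' := by
    rintro e ⟨-, f, hf, rfl⟩
    exact Set.inter_subset_inter_left S (H.subset_vertexSet_of_mem_edgeSet' hf)

/-- `H \ x`, the subhypergraph of `H` induced by all vertices other than `x`. -/
def deleteVertex (H : Hypergraph α) (x : α) : Hypergraph α :=
  H.induce (H.vertexSet \ {x})

/-- A vertex is a nest point if the edges that contain it form a chain for inclusion. -/
def IsNestPoint (H : Hypergraph α) (x : α) : Prop :=
  x ∈ H.vertexSet ∧ IsChain (fun e f : Set α => e ⊆ f) {e | e ∈ H.edgeSet ∧ x ∈ e}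

/-- The empty tuple is a β-elimination order of the hypergraph without vertices, and
`(x₁, …, xₙ)` is a β-elimination order of `H` if `x₁` is a nest point of `H` and `(x₂, …, xₙ)` is a
β-elimination order of `H \ x₁`. -/
def IsBetaEliminationOrder : Hypergraph α → List α → Prop
  | H, [] => H.vertexSet = ∅
  | H, x :: xs => H.IsNestPoint x ∧ IsBetaEliminationOrder (H.deleteVertex x) xs

/-- A hypergraph is β-acyclic if it has a β-elimination order. -/
def IsBetaAcyclic (H : Hypergraph α) : Prop :=
  ∃ xs : List α, H.IsBetaEliminationOrder xs

end Hypergraph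

/-! ### CNF formulas -/

namespace SAT

/-- A literal: a variable, named by a natural number, with its sign (`true` for the variable itself,
`false` for its negation). -/
structure Literal where
  var : ℕ
  sign : Bool

/-- A clause, written down as a list of literals. The empty clause, repeated literals, and clauses
that contain a variable and its negation are all allowed. -/
abbrev Clause : Type := List Literal

/-- A CNF formula, written down as a list of clauses. -/
abbrev CNF : Type := List Clause

/-- The set of variables that occur in a clause. -/
def Clause.vars (C : Clause) : Finset ℕ :=
  (C.map Literal.var).toFinset

/-- The set of variables that occur in a formula. -/
def CNF.vars (F : CNF) : Finset ℕ :=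
  (F.flatten.map Literal.var).toFinset

theorem Clause.vars_subset {F : CNF} {C : Clause} (hC : C ∈ F) :
    Clause.vars C ⊆ CNF.vars F := by
  intro v hv
  simp only [Clause.vars, CNF.vars, List.mem_toFinset, List.mem_map] at hv ⊢
  obtain ⟨l, hl, rfl⟩ := hv
  exact ⟨l, List.mem_flatten.2 ⟨C, hC, hl⟩, rfl⟩

/-- The hypergraph of a formula: its vertices are the variables of the formula, and its edges are
the variable sets of the clauses. Edges of a hypergraph are non-empty by convention, so an empty
clause contributes none. -/
def CNF.hypergraph (F : CNF) : Hypergraph ℕ where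
  vertexSet := ↑(CNF.vars F)
  edgeSet := {e | e.Nonempty ∧ ∃ C ∈ F, e = ↑(Clause.vars C)}
  subset_vertexSet_of_mem_edgeSet' := by
    rintro e ⟨-, C, hC, rfl⟩
    exact Finset.coe_subset.2 (Clause.vars_subset hC)

/-- An assignment to the variables of `F` satisfies `F` if in every clause it makes some literal
true. -/
def CNF.IsSatisfiedBy (F : CNF) (a : CNF.vars F → Bool) : Prop :=
  ∀ C ∈ F, ∃ l ∈ C, ∃ h : l.var ∈ CNF.vars F, a ⟨l.var, h⟩ = l.sign

/-- The number of satisfying assignments of `F` to its variables. -/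
noncomputable def CNF.numSat (F : CNF) : ℕ :=
  Nat.card {a : CNF.vars F → Bool // F.IsSatisfiedBy a}

/-- The code of a literal: `2 v + 1` for the variable `v` and `2 v + 2` for its negation. -/
def Literal.encode (l : Literal) : ℕ :=
  if l.sign then 2 * l.var + 1 else 2 * l.var + 2

/-- The code of a formula: its clauses one after the other, each one written as the codes of its
literals followed by the end marker `0`. -/
def CNF.encode (F : CNF) : List ℕ :=
  F.flatMap fun C => C.map Literal.encode ++ [0]

end SAT

/-! ### Random access machines with logarithmic cost

The memory consists of cells addressed by natural numbers, each of which holds a natural number. A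
program may compute addresses, add, subtract, multiply, divide, branch and loop. Every operation
and every memory access is charged the number of bits of the numbers involved. -/

namespace RAM

/-- The content of the memory. -/
abbrev Memory : Type := ℕ → ℕ

/-- Arithmetic expressions over the memory; `load e` is the content of the cell whose address is the
value of `e`. -/
inductive Expr where
  | const (n : ℕ)
  | load (addr : Expr)
  | add (e₁ e₂ : Expr)
  | sub (e₁ e₂ : Expr)
  | mul (e₁ e₂ : Expr)
  | div (e₁ e₂ : Expr)

/-- The value of an expression. Subtraction is truncated at `0`, division is rounded down, and
division by `0` gives `0`. -/
def Expr.eval (m : Memory) : Expr → ℕ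
  | .const n => n
  | .load e => m (e.eval m)
  | .add e₁ e₂ => e₁.eval m + e₂.eval m
  | .sub e₁ e₂ => e₁.eval m - e₂.eval m
  | .mul e₁ e₂ => e₁.eval m * e₂.eval m
  | .div e₁ e₂ => e₁.eval m / e₂.eval m

/-- The logarithmic cost of a number: its number of binary digits, plus `1`. -/
def logCost (n : ℕ) : ℕ := Nat.size n + 1

/-- The cost of evaluating an expression: the logarithmic cost of the values of all its
subexpressions, hence of all operands, results, and addresses used. -/
def Expr.cost (m : Memory) : Expr → ℕ
  | .const n => logCost n
  | .load e => e.cost m + logCost ((Expr.load e).eval m)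
  | .add e₁ e₂ => e₁.cost m + e₂.cost m + logCost ((Expr.add e₁ e₂).eval m)
  | .sub e₁ e₂ => e₁.cost m + e₂.cost m + logCost ((Expr.sub e₁ e₂).eval m)
  | .mul e₁ e₂ => e₁.cost m + e₂.cost m + logCost ((Expr.mul e₁ e₂).eval m)
  | .div e₁ e₂ => e₁.cost m + e₂.cost m + logCost ((Expr.div e₁ e₂).eval m)

/-- Programs. `store e₁ e₂` writes the value of `e₂` to the cell whose address is the value of `e₁`;
a condition counts as true if its value is not `0`. -/
inductive Program where
  | skip
  | store (addr val : Expr)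
  | seq (p q : Program)
  | ite (cond : Expr) (p q : Program)
  | loop (cond : Expr) (body : Program)

/-- `Runs p m t m'`: started on the memory `m`, the program `p` halts after time `t`, with the
memory `m'`. -/
inductive Runs : Program → Memory → ℕ → Memory → Prop where
  | skip (m : Memory) : Runs .skip m 1 m
  | store (m : Memory) (e₁ e₂ : Expr) :
      Runs (.store e₁ e₂) m (e₁.cost m + e₂.cost m + 1)
        (Function.update m (e₁.eval m) (e₂.eval m))
  | seq {p q : Program} {m m' m'' : Memory} {t t' : ℕ} :
      Runs p m t m' → Runs q m' t' m'' → Runs (.seq p q) m (t + t') m''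
  | ite_true {e : Expr} {p q : Program} {m m' : Memory} {t : ℕ} :
      e.eval m ≠ 0 → Runs p m t m' → Runs (.ite e p q) m (e.cost m + t + 1) m'
  | ite_false {e : Expr} {p q : Program} {m m' : Memory} {t : ℕ} :
      e.eval m = 0 → Runs q m t m' → Runs (.ite e p q) m (e.cost m + t + 1) m'
  | loop_true {e : Expr} {p : Program} {m m' m'' : Memory} {t t' : ℕ} :
      e.eval m ≠ 0 → Runs p m t m' → Runs (.loop e p) m' t' m'' →
        Runs (.loop e p) m (e.cost m + t + t' + 1) m''
  | loop_false {e : Expr} {p : Program} {m : Memory} :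
      e.eval m = 0 → Runs (.loop e p) m (e.cost m + 1) m

/-- The initial memory on an input word `w`: cell `0` holds the length of `w`, the following cells
hold its entries, and all other cells hold `0`. -/
def initMemory (w : List ℕ) : Memory := fun i => (w.length :: w).getD i 0

/-- The bit length of an input word. -/
def bitLength (w : List ℕ) : ℕ := (w.map logCost).sum

/-- The function `f` can be computed in polynomial time on the inputs in `S`: there are one program
and one polynomial such that on the code of every `x ∈ S` the program halts with `f x` in cell `0`,
after a time that is at most the polynomial in the bit length of the code. -/
def PolyTimeComputableOn {X : Type} (encode : X → List ℕ) (S : Set X) (f : X → ℕ) : Prop :=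
  ∃ (p : Program) (P : Polynomial ℕ), ∀ x ∈ S, ∃ (t : ℕ) (m : Memory),
    Runs p (initMemory (encode x)) t m ∧ t ≤ P.eval (bitLength (encode x)) ∧ m 0 = f x

end RAM

/-! The count is obtained by eliminating the variables one at a time from a system of weighted
clauses. A falsified clause contributes a weight, a satisfied one contributes `1`, and the task is
to sum the products of these factors over all assignments.

Let `k` be the nest point that is eliminated, and fix the values of the later variables. The clauses
containing `k` that are still falsified on the later variables have nested variable sets. List them
by a rank compatible with inclusion, as `i₁, …, i_m`. Which clauses precede `i_t` in this list is
determined by `i_t` alone: they are those of smaller rank that it subsumes above `k`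
(`mem_below_iff`). If `split J` is the sum over both values of `k` of the product of the weights in
`J`, then the new weight of `i_t`, namely `split {i₁, …, i_t} / split {i₁, …, i_{t-1}}`, does not
depend on the values that were fixed. The product of the new weights telescopes to `split {i₁, …,
i_m} / 2` (`split_eq_two_mul_prod`). So summing over `k` only changes the weights and gives a factor
`2`; after all eliminations the total is a power of `2` times the product of the final weights
(`count_eq`, `two_pow_mul_prod_weight`).

Weight `0` for falsified clauses would count satisfying assignments directly, but could lead to
divisions by zero. Instead every clause that is not a tautology has the initial weight `2 ^ len`,
where `len` is the input length plus `2`. There are fewer than `2 ^ len` satisfying assignments,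
each contributes `1`, and every other assignment contributes a multiple of `2 ^ len`, so the count
is the total modulo `2 ^ len` (`totalWeight_mod`).

The intermediate weights stay small because each is the quotient of two weighted counts of
extensions, for the clauses of rank up to and including that of `i` and for those of strictly
smaller rank (`count_rank_succ`). Hence its reduced numerator and denominator divide numbers of
polynomial bit length (`le_of_weight_eq`), and the Euclidean algorithm reduces the fractions in
every round. An elimination order is found greedily, since every nonempty set of vertices induces a
subhypergraph with a nest point (`exists_nest`).

For the running time, the algorithm is written in a small array language whose loops have `len`
rounds and whose assignments truncate at `2 ^ len ^ 5`. Every program of this language compiles to a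
polynomial-time machine program (`polyTimeComputableOn_of_exec`); the bounds above show that the
truncation does not alter the arithmetic data of the counting program. -/

namespace RAM

open Polynomial

/-! ### Costs of machine expressions, stores and counting loops -/

/-- All memory cells hold numbers of at most `Y` bits. -/
def Memory.Bdd (m : Memory) (Y : ℕ) : Prop := ∀ i, m i < 2 ^ Y

theorem Memory.Bdd.update {m : Memory} {Y : ℕ} (h : m.Bdd Y) (a : ℕ) {v : ℕ} (hv : v < 2 ^ Y) :
    Memory.Bdd (Function.update m a v) Y := by
  intro i
  by_cases hi : i = a
  · subst hi; simpa using hv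
  · simpa [hi] using h i

theorem logCost_le {v b : ℕ} (h : v < 2 ^ b) : logCost v ≤ b + 1 :=
  Nat.succ_le_succ (Nat.size_le.2 h)

/-- A fixed expression performs a fixed number of operations, and each result has at most about as
many bits as its operands together. Both value size and cost are therefore linear in the bit length
`Y` of the cells. -/
theorem Expr.exists_bound (e : Expr) : ∃ c : ℕ, ∀ (m : Memory) (Y : ℕ), m.Bdd Y →
    e.eval m < 2 ^ (c * (Y + 1)) ∧ e.cost m ≤ c * (Y + 1) := by
  have key : ∀ (c₁ c₂ Y v t₁ t₂ : ℕ), v < 2 ^ ((c₁ + c₂ + 1) * (Y + 1)) →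
      t₁ ≤ c₁ * (Y + 1) → t₂ ≤ c₂ * (Y + 1) →
      v < 2 ^ ((2 * (c₁ + c₂ + 1)) * (Y + 1)) ∧
        t₁ + t₂ + logCost v ≤ (2 * (c₁ + c₂ + 1)) * (Y + 1) := by
    intro c₁ c₂ Y v t₁ t₂ hv h₁ h₂
    refine ⟨hv.trans_le (Nat.pow_le_pow_right (by norm_num) (by nlinarith)), ?_⟩
    have := logCost_le hv
    nlinarith
  have mono : ∀ {a c Y : ℕ}, a ≤ c → 2 ^ (a * (Y + 1)) ≤ 2 ^ (c * (Y + 1)) := fun h =>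
    Nat.pow_le_pow_right (by norm_num) (Nat.mul_le_mul_right _ h)
  induction e with
  | const n =>
    refine ⟨n + 1, fun m Y _ => ?_⟩
    have h : n < 2 ^ n := Nat.lt_two_pow_self
    have := logCost_le h
    refine ⟨h.trans_le (Nat.pow_le_pow_right (by norm_num) (by nlinarith)), ?_⟩
    simp only [Expr.cost]
    nlinarith
  | load e ih =>
    obtain ⟨c, hc⟩ := ih
    refine ⟨c + 1, fun m Y hm => ?_⟩
    have h := hm (e.eval m)
    have := logCost_le h
    refine ⟨h.trans_le (Nat.pow_le_pow_right (by norm_num) (by nlinarith)), ?_⟩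
    simp only [Expr.cost, Expr.eval]
    have := (hc m Y hm).2
    nlinarith
  | add e₁ e₂ ih₁ ih₂ =>
    obtain ⟨c₁, h₁⟩ := ih₁
    obtain ⟨c₂, h₂⟩ := ih₂
    refine ⟨_, fun m Y hm => key c₁ c₂ Y _ _ _ ?_ (h₁ m Y hm).2 (h₂ m Y hm).2⟩
    have a₁ := (h₁ m Y hm).1.trans_le (mono (show c₁ ≤ c₁ + c₂ by omega))
    have a₂ := (h₂ m Y hm).1.trans_le (mono (show c₂ ≤ c₁ + c₂ by omega))
    calc e₁.eval m + e₂.eval m < 2 ^ ((c₁ + c₂) * (Y + 1)) * 2 ^ 1 := by omega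
      _ ≤ _ := by
        rw [← pow_add]
        exact Nat.pow_le_pow_right (by norm_num) (by nlinarith)
  | sub e₁ e₂ ih₁ ih₂ =>
    obtain ⟨c₁, h₁⟩ := ih₁
    obtain ⟨c₂, h₂⟩ := ih₂
    refine ⟨_, fun m Y hm => key c₁ c₂ Y _ _ _ ?_ (h₁ m Y hm).2 (h₂ m Y hm).2⟩
    exact (Nat.sub_le _ _).trans_lt ((h₁ m Y hm).1.trans_le (mono (by omega)))
  | mul e₁ e₂ ih₁ ih₂ =>
    obtain ⟨c₁, h₁⟩ := ih₁
    obtain ⟨c₂, h₂⟩ := ih₂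
    refine ⟨_, fun m Y hm => key c₁ c₂ Y _ _ _ ?_ (h₁ m Y hm).2 (h₂ m Y hm).2⟩
    calc e₁.eval m * e₂.eval m < 2 ^ (c₁ * (Y + 1)) * 2 ^ (c₂ * (Y + 1)) :=
          Nat.mul_lt_mul'' (h₁ m Y hm).1 (h₂ m Y hm).1
      _ ≤ _ := by
        rw [← pow_add]
        exact Nat.pow_le_pow_right (by norm_num) (by nlinarith)
  | div e₁ e₂ ih₁ ih₂ =>
    obtain ⟨c₁, h₁⟩ := ih₁
    obtain ⟨c₂, h₂⟩ := ih₂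
    refine ⟨_, fun m Y hm => key c₁ c₂ Y _ _ _ ?_ (h₁ m Y hm).2 (h₂ m Y hm).2⟩
    exact (Nat.div_le_self _ _).trans_lt ((h₁ m Y hm).1.trans_le (mono (by omega)))

/-- Started on `m`, the program `p` halts within time `T` in a memory that satisfies `Q`. -/
def HaltsWith (p : Program) (m : Memory) (T : ℕ) (Q : Memory → Prop) : Prop :=
  ∃ t m', Runs p m t m' ∧ t ≤ T ∧ Q m'

theorem HaltsWith.mono {p : Program} {m : Memory} {T T' : ℕ} {Q Q' : Memory → Prop}
    (h : HaltsWith p m T Q) (hT : T ≤ T') (hQ : ∀ m', Q m' → Q' m') : HaltsWith p m T' Q' := by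
  obtain ⟨t, m', h₁, h₂, h₃⟩ := h
  exact ⟨t, m', h₁, h₂.trans hT, hQ _ h₃⟩

theorem HaltsWith.seq {p q : Program} {m : Memory} {T T' : ℕ} {Q Q' : Memory → Prop}
    (h : HaltsWith p m T Q) (h' : ∀ m', Q m' → HaltsWith q m' T' Q') :
    HaltsWith (.seq p q) m (T + T') Q' := by
  obtain ⟨t, m', h₁, h₂, h₃⟩ := h
  obtain ⟨t', m'', h₁', h₂', h₃'⟩ := h' m' h₃
  exact ⟨t + t', m'', h₁.seq h₁', add_le_add h₂ h₂', h₃'⟩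

theorem exists_haltsWith_store (e₁ e₂ : Expr) : ∃ P : ℕ[X], ∀ (m : Memory) (Y : ℕ), m.Bdd Y →
    HaltsWith (.store e₁ e₂) m (P.eval Y)
      (fun m' => m' = Function.update m (e₁.eval m) (e₂.eval m)) := by
  obtain ⟨c₁, h₁⟩ := e₁.exists_bound
  obtain ⟨c₂, h₂⟩ := e₂.exists_bound
  refine ⟨C (c₁ + c₂ + 1) * (X + 1), fun m Y hm => ⟨_, _, .store m e₁ e₂, ?_, rfl⟩⟩
  have := (h₁ m Y hm).2
  have := (h₂ m Y hm).2
  simp only [eval_mul, eval_C, eval_add, eval_X, eval_one]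
  nlinarith

theorem haltsWith_loop {cond : Expr} {body : Program} {K T A : ℕ} {Inv : ℕ → Memory → Prop}
    (hcond : ∀ i ≤ K, ∀ m, Inv i m → cond.eval m = K - i ∧ cond.cost m ≤ A)
    (hbody : ∀ i < K, ∀ m, Inv i m → HaltsWith body m T (Inv (i + 1)))
    {m : Memory} (h₀ : Inv 0 m) :
    HaltsWith (.loop cond body) m ((K + 1) * (A + T + 1)) (Inv K) := by
  have aux : ∀ j i, i + j = K → ∀ m, Inv i m →
      HaltsWith (.loop cond body) m ((j + 1) * (A + T + 1)) (Inv K) := by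
    intro j
    induction j with
    | zero =>
      intro i hi m hm
      obtain rfl : i = K := by omega
      obtain ⟨h₁, h₂⟩ := hcond i le_rfl m hm
      exact ⟨_, m, .loop_false (by omega), by omega, hm⟩
    | succ j ih =>
      intro i hi m hm
      obtain ⟨h₁, h₂⟩ := hcond i (by omega) m hm
      obtain ⟨t, m', r, ht, hm'⟩ := hbody i (by omega) m hm
      obtain ⟨t', m'', r', ht', hm''⟩ := ih (i + 1) (by omega) m' hm'
      exact ⟨_, m'', .loop_true (by omega) r r', by nlinarith, hm''⟩
  exact aux K 0 (by omega) m h₀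

/-! ### A language of array programs -/

/-- The arithmetic operations of the machine. -/
inductive Op where
  | add | sub | mul | div

/-- The value of an operation. -/
def Op.eval : Op → ℕ → ℕ → ℕ
  | .add, x, y => x + y
  | .sub, x, y => x - y
  | .mul, x, y => x * y
  | .div, x, y => x / y

/-- The machine expression for an operation. -/
def Op.expr : Op → Expr → Expr → Expr
  | .add => .add
  | .sub => .sub
  | .mul => .mul
  | .div => .div

@[simp] theorem Op.eval_expr (o : Op) (e₁ e₂ : Expr) (m : Memory) :
    (o.expr e₁ e₂).eval m = o.eval (e₁.eval m) (e₂.eval m) := by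
  cases o <;> rfl

/-- The contents of the arrays of an array program. -/
abbrev ArrState : Type := Fin 14 → ℕ → ℕ

/-- Prepend a value to an environment. -/
def push (i : ℕ) (ρ : ℕ → ℕ) : ℕ → ℕ
  | 0 => i
  | n + 1 => ρ n

@[simp] theorem push_zero (i : ℕ) (ρ : ℕ → ℕ) : push i ρ 0 = i := rfl
@[simp] theorem push_succ (i : ℕ) (ρ : ℕ → ℕ) (n : ℕ) : push i ρ (n + 1) = ρ n := rfl

/-- The sum, or the product, of the first `n` values of `f`. -/
def aggregate (isProd : Bool) (n : ℕ) (f : ℕ → ℕ) : ℕ :=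
  if isProd then ∏ i ∈ Finset.range n, f i else ∑ i ∈ Finset.range n, f i

/-- Expressions of array programs over an input word `w`. Variables are de Bruijn indices, and
`agg` forms the sum or the product of the values of an expression, for the values of a new variable
below `len = |w| + 2`. -/
inductive Ex where
  | const (n : ℕ)
  | var (n : ℕ)
  | len
  | inp (n : ℕ)
  | arr (a : Fin 14) (e : Ex)
  | bin (o : Op) (e₁ e₂ : Ex)
  | agg (isProd : Bool) (e : Ex)

/-- The value of an expression of an array program. -/
def Ex.eval (w : List ℕ) (s : ArrState) : Ex → (ℕ → ℕ) → ℕ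
  | .const n, _ => n
  | .var n, ρ => ρ n
  | .len, _ => w.length + 2
  | .inp n, ρ => w.getD (ρ n) 0
  | .arr a e, ρ => s a (e.eval w s ρ)
  | .bin o e₁ e₂, ρ => o.eval (e₁.eval w s ρ) (e₂.eval w s ρ)
  | .agg p e, ρ => aggregate p (w.length + 2) fun i => e.eval w s (push i ρ)

/-- A bound for the bit lengths of the values of an expression and its subexpressions. -/
noncomputable def Ex.bits : Ex → ℕ[X]
  | .const n => C n
  | .var _ => X
  | .len => X
  | .inp _ => X
  | .arr _ e => X + e.bits
  | .bin _ e₁ e₂ => e₁.bits + e₂.bits + 1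
  | .agg _ e => X * e.bits + X + 1

/-- The input word and the arrays consist of numbers of at most `Z` bits. -/
structure Small (w : List ℕ) (s : ArrState) (Z : ℕ) : Prop where
  len : w.length + 2 ≤ Z
  inp : ∀ i, w.getD i 0 < 2 ^ Z
  arr : ∀ a i, s a i < 2 ^ Z

theorem aggregate_lt {p : Bool} {n Z b : ℕ} {f : ℕ → ℕ} (hn : n ≤ Z) (hf : ∀ i < n, f i < 2 ^ b) :
    aggregate p n f < 2 ^ (Z * b + Z + 1) := by
  unfold aggregate
  split
  · calc ∏ i ∈ Finset.range n, f i ≤ ∏ i ∈ Finset.range n, 2 ^ b :=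
          Finset.prod_le_prod' fun i hi => (hf i (Finset.mem_range.1 hi)).le
      _ = 2 ^ (b * n) := by simp [pow_mul]
      _ < _ := Nat.pow_lt_pow_right (by norm_num) (by nlinarith)
  · rcases Nat.eq_zero_or_pos n with rfl | hpos
    · simp
    calc ∑ i ∈ Finset.range n, f i ≤ ∑ i ∈ Finset.range n, 2 ^ b :=
          Finset.sum_le_sum fun i hi => (hf i (Finset.mem_range.1 hi)).le
      _ = n * 2 ^ b := by simp
      _ ≤ 2 ^ Z * 2 ^ b := Nat.mul_le_mul_right _ (hn.trans Nat.lt_two_pow_self.le)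
      _ = 2 ^ (Z + b) := (pow_add _ _ _).symm
      _ < _ := Nat.pow_lt_pow_right (by norm_num) (by nlinarith)

theorem aggregate_succ (p : Bool) (n : ℕ) (f : ℕ → ℕ) :
    aggregate p (n + 1) f = (bif p then Op.mul else Op.add).eval (aggregate p n f) (f n) := by
  cases p <;> simp [aggregate, Op.eval, Finset.prod_range_succ, Finset.sum_range_succ]

theorem Ex.eval_lt {w : List ℕ} {s : ArrState} {Z : ℕ} (h : Small w s Z) (e : Ex) :
    ∀ ρ : ℕ → ℕ, (∀ n, ρ n < w.length + 2) → e.eval w s ρ < 2 ^ e.bits.eval Z := by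
  have hlt : w.length + 2 < 2 ^ Z := h.len.trans_lt Nat.lt_two_pow_self
  induction e with
  | const n => intro ρ _; simpa [Ex.eval, Ex.bits] using Nat.lt_two_pow_self
  | var n => intro ρ hρ; simpa [Ex.eval, Ex.bits] using (hρ n).trans hlt
  | len => intro ρ _; simpa [Ex.eval, Ex.bits] using hlt
  | inp n => intro ρ _; simpa [Ex.eval, Ex.bits] using h.inp _
  | arr a e ih =>
    intro ρ _
    simp only [Ex.eval, Ex.bits, eval_add, eval_X]
    exact (h.arr _ _).trans_le (Nat.pow_le_pow_right (by norm_num) (by omega))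
  | bin o e₁ e₂ ih₁ ih₂ =>
    intro ρ hρ
    have h₁ := ih₁ ρ hρ
    have h₂ := ih₂ ρ hρ
    simp only [Ex.eval, Ex.bits, eval_add, eval_one]
    generalize e₁.eval w s ρ = x at *
    generalize e₂.eval w s ρ = y at *
    generalize e₁.bits.eval Z = b at *
    generalize e₂.bits.eval Z = c at *
    have hb : 2 ^ b ≤ 2 ^ (b + c) := Nat.pow_le_pow_right (by norm_num) (by omega)
    have hc : 2 ^ c ≤ 2 ^ (b + c) := Nat.pow_le_pow_right (by norm_num) (by omega)
    rw [pow_succ]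
    cases o
    · simp only [Op.eval]; omega
    · simp only [Op.eval]; omega
    · simp only [Op.eval]
      have := Nat.mul_lt_mul'' h₁ h₂
      rw [← pow_add] at this
      omega
    · simp only [Op.eval]
      have := Nat.div_le_self x y
      omega
  | agg p e ih =>
    intro ρ hρ
    simp only [Ex.eval, Ex.bits, eval_add, eval_mul, eval_X, eval_one]
    refine aggregate_lt h.len fun i hi => ih _ ?_
    rintro (_ | n)
    · exact hi
    · exact hρ n

/-! ### Compilation of expressions -/

/-- The cell that holds the entry with index `i` of the array `a`, for an input of length `L`. -/
def addr (L a i : ℕ) : ℕ := L + (16 * i + (3 + a))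

/-- Sixteen arrays are interleaved: `0` to `13` belong to the array program, `14` is a buffer for
simultaneous assignments, and `15` holds the registers. -/
theorem addr_inj {L a b i j : ℕ} (ha : a < 16) (hb : b < 16) :
    addr L a i = addr L b j ↔ a = b ∧ i = j := by
  unfold addr; omega

/-- The offset `3` protects the length in cell `0`, the input word, and two further cells that stay
`0`, so that reading the input at any index below `L + 2` gives the value of `getD`. -/
theorem addr_ne_input {L a i j : ℕ} (hj : j < L + 3) : j ≠ addr L a i := by
  unfold addr; omega

/-- The address of an array entry as a machine expression. -/
def cellE (a : ℕ) (e : Expr) : Expr :=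
  .add (.load (.const 0)) (.add (.mul (.const 16) e) (.const (3 + a)))

/-- The address of the register `d`. -/
def regE (d : ℕ) : Expr := cellE 15 (.const d)

/-- The content of the register `d`. -/
def getE (d : ℕ) : Expr := .load (regE d)

/-- The content of the register `d`, for an input of length `L`. -/
def Memory.reg (m : Memory) (L d : ℕ) : ℕ := m (addr L 15 d)

theorem eval_cellE {m : Memory} {L : ℕ} (h : m 0 = L) (a : ℕ) (e : Expr) :
    (cellE a e).eval m = addr L a (e.eval m) := by
  simp [cellE, Expr.eval, addr, h]

theorem eval_regE {m : Memory} {L : ℕ} (h : m 0 = L) (d : ℕ) :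
    (regE d).eval m = addr L 15 d := by
  simp [regE, eval_cellE h, Expr.eval]

theorem eval_getE {m : Memory} {L : ℕ} (h : m 0 = L) (d : ℕ) :
    (getE d).eval m = m.reg L d := by
  simp [getE, Expr.eval, eval_regE h, Memory.reg]

/-- Execute `body` for the values `0, …, |w| + 1` of the register `d`. -/
def forLoop (d : ℕ) (body : Program) : Program :=
  .seq (.store (regE d) (.const 0))
    (.loop (.sub (.add (.load (.const 0)) (.const 2)) (getE d))
      (.seq body (.store (regE d) (.add (getE d) (.const 1)))))

/-- The overhead polynomial depends on the counter register only, so it is uniform in the body and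
the input. The invariant has to tolerate writes to the counter register, and the body has to
preserve that register. -/
theorem exists_haltsWith_forLoop (d : ℕ) : ∃ P : ℕ[X], ∀ (body : Program) (L T Y : ℕ)
    (Inv : ℕ → Memory → Prop), L + 2 ≤ Y →
    (∀ i m, Inv i m → m 0 = L ∧ m.Bdd Y) →
    (∀ i m v, Inv i m → v < 2 ^ Y → Inv i (Function.update m (addr L 15 d) v)) →
    (∀ i < L + 2, ∀ m, Inv i m → m.reg L d = i →
      HaltsWith body m T (fun m' => m'.reg L d = i ∧ Inv (i + 1) m')) →
    ∀ m, Inv 0 m → HaltsWith (forLoop d body) m ((P.eval Y + T) * (Y + 1)) (Inv (L + 2)) := by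
  obtain ⟨P₁, h₁⟩ := exists_haltsWith_store (regE d) (.const 0)
  obtain ⟨P₂, h₂⟩ := exists_haltsWith_store (regE d) (.add (getE d) (.const 1))
  obtain ⟨c, hc⟩ := Expr.exists_bound (.sub (.add (.load (.const 0)) (.const 2)) (getE d))
  refine ⟨P₁ + P₂ + C c * (X + 1) + 1, fun body L T Y Inv hL hI hst hbody m hm => ?_⟩
  have hpos : 0 < 2 ^ Y := by positivity
  have hlt : L + 2 < 2 ^ Y := hL.trans_lt Nat.lt_two_pow_self
  have hloop := haltsWith_loop (cond := .sub (.add (.load (.const 0)) (.const 2)) (getE d))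
    (body := .seq body (.store (regE d) (.add (getE d) (.const 1)))) (K := L + 2)
    (T := T + P₂.eval Y) (A := c * (Y + 1)) (Inv := fun i m => Inv i m ∧ m.reg L d = i)
    (m := Function.update m (addr L 15 d) 0) ?_ ?_ ⟨hst 0 m 0 hm hpos, by simp [Memory.reg]⟩
  · refine ((h₁ m Y (hI 0 m hm).2).seq
      (T' := (L + 2 + 1) * (c * (Y + 1) + (T + P₂.eval Y) + 1)) (Q' := Inv (L + 2))
      fun m' hm' => ?_).mono ?_ fun _ h => h
    · rw [eval_regE (hI 0 m hm).1] at hm'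
      rw [hm']
      exact hloop.mono le_rfl fun m' h => h.1
    · simp only [eval_add, eval_mul, eval_C, eval_X, eval_one]
      have : (L + 2 + 1) * (c * (Y + 1) + (T + P₂.eval Y) + 1) ≤
        (Y + 1) * (c * (Y + 1) + (T + P₂.eval Y) + 1) := Nat.mul_le_mul_right _ (by omega)
      nlinarith [Nat.zero_le (P₁.eval Y * Y)]
  · rintro i hi m ⟨hm, hr⟩
    refine ⟨?_, (hc m Y (hI i m hm).2).2⟩
    simp only [Expr.eval, (hI i m hm).1, eval_getE (hI i m hm).1, hr]
  · rintro i hi m ⟨hm, hr⟩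
    refine (hbody i hi m hm hr).seq fun m' hm' => ?_
    obtain ⟨hr', hI'⟩ := hm'
    refine (h₂ m' Y (hI _ _ hI').2).mono le_rfl ?_
    rintro m'' rfl
    rw [eval_regE (hI _ _ hI').1]
    simp only [Expr.eval, eval_getE (hI _ _ hI').1, hr']
    exact ⟨hst _ _ _ hI' (by omega), by simp [Memory.reg]⟩

/-- The program that computes the value of an expression in the register `d`. The value of the
variable `n` is in the register `loc n`. -/
def Ex.compile : Ex → (ℕ → ℕ) → ℕ → Program
  | .const n, _, d => .store (regE d) (.const n)
  | .var n, loc, d => .store (regE d) (getE (loc n))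
  | .len, _, d => .store (regE d) (.add (.load (.const 0)) (.const 2))
  | .inp n, loc, d => .store (regE d) (.load (.add (getE (loc n)) (.const 1)))
  | .arr a e, loc, d => .seq (e.compile loc d) (.store (regE d) (.load (cellE a (getE d))))
  | .bin o e₁ e₂, loc, d => .seq (e₁.compile loc d) (.seq (e₂.compile loc (d + 1))
      (.store (regE d) (o.expr (getE d) (getE (d + 1)))))
  -- Register `d` accumulates, `d + 1` holds the bound variable, and `d + 2` receives the value of
  -- the body.
  | .agg p e, loc, d => .seq (.store (regE d) (.const (bif p then 1 else 0)))
      (forLoop (d + 1) (.seq (e.compile (push (d + 1) loc) (d + 2))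
        (.store (regE d) ((bif p then Op.mul else Op.add).expr (getE d) (getE (d + 2))))))

/-- The memory `m` holds the input word `w` and the arrays `s`. -/
structure Represents (w : List ℕ) (s : ArrState) (m : Memory) : Prop where
  len : m 0 = w.length
  inp : ∀ i < w.length + 2, m (i + 1) = w.getD i 0
  arr : ∀ (a : Fin 14) i, m (addr w.length a i) = s a i

/-- The memories `m` and `m'` differ in the registers from `d` on only. -/
def EqBelow (L d : ℕ) (m m' : Memory) : Prop :=
  ∀ x, (∀ d' ≥ d, x ≠ addr L 15 d') → m' x = m x

theorem EqBelow.refl (L d : ℕ) (m : Memory) : EqBelow L d m m := fun _ _ => rfl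

theorem EqBelow.trans {L d : ℕ} {m m' m'' : Memory} (h : EqBelow L d m m')
    (h' : EqBelow L d m' m'') : EqBelow L d m m'' := fun x hx => (h' x hx).trans (h x hx)

theorem EqBelow.mono {L d d' : ℕ} {m m' : Memory} (h : EqBelow L d m m') (hd : d' ≤ d) :
    EqBelow L d' m m' := fun x hx => h x fun e he => hx e (hd.trans he)

theorem EqBelow.update {L d d' : ℕ} {m m' : Memory} (h : EqBelow L d m m') (hd : d ≤ d') (v : ℕ) :
    EqBelow L d m (Function.update m' (addr L 15 d') v) := fun x hx => by
  rw [Function.update_of_ne (hx d' hd), h x hx]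

theorem EqBelow.reg {L d d' : ℕ} {m m' : Memory} (h : EqBelow L d m m') (hd : d' < d) :
    m'.reg L d' = m.reg L d' := h _ fun e he => by
  rw [Ne, addr_inj (by norm_num) (by norm_num)]; omega

theorem EqBelow.represents {w : List ℕ} {s : ArrState} {d : ℕ} {m m' : Memory}
    (h : EqBelow w.length d m m') (hm : Represents w s m) : Represents w s m' where
  len := by rw [h 0 fun _ _ => addr_ne_input (by omega), hm.len]
  inp i hi := by rw [h _ fun _ _ => addr_ne_input (by omega), hm.inp i hi]
  arr a i := by
    rw [h _ fun e _ => ?_, hm.arr]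
    rw [Ne, addr_inj (by omega) (by norm_num)]; omega

theorem reg_update {m : Memory} {L d d' v : ℕ} :
    Memory.reg (Function.update m (addr L 15 d) v) L d' = if d' = d then v else m.reg L d' := by
  unfold Memory.reg
  split
  · next h => subst h; simp
  · next h =>
    rw [Function.update_of_ne]
    rw [Ne, addr_inj (by norm_num) (by norm_num)]; omega

/-- Two bit bounds are kept apart: `Z` for the input and the arrays, and `Y` for the whole memory
including the registers. Since intermediate values are bounded in terms of `Z`, the same `Y` is
valid before and after the evaluation and does not grow from one evaluation to the next. -/
theorem Ex.exists_haltsWith_compile (e : Ex) : ∀ (loc : ℕ → ℕ) (d : ℕ), ∃ P : ℕ[X],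
    ∀ (w : List ℕ) (s : ArrState) (m : Memory) (ρ : ℕ → ℕ) (Z Y : ℕ), Small w s Z →
    Represents w s m → (∀ n, loc n < d ∧ m.reg w.length (loc n) = ρ n ∧ ρ n < w.length + 2) →
    Z ≤ Y → e.bits.eval Z ≤ Y → m.Bdd Y →
    HaltsWith (e.compile loc d) m (P.eval Y) fun m' =>
      m'.reg w.length d = e.eval w s ρ ∧ EqBelow w.length d m m' ∧ m'.Bdd Y := by
  have simple : ∀ (d : ℕ) (ex : Expr), ∃ P : ℕ[X], ∀ (L v : ℕ) (m m₀ : Memory) (Y : ℕ),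
      m 0 = L → m.Bdd Y → EqBelow L d m₀ m → ex.eval m = v → v < 2 ^ Y →
      HaltsWith (.store (regE d) ex) m (P.eval Y)
        fun m' => m'.reg L d = v ∧ EqBelow L d m₀ m' ∧ m'.Bdd Y := by
    intro d ex
    obtain ⟨P, hP⟩ := exists_haltsWith_store (regE d) ex
    refine ⟨P, fun L v m m₀ Y h0 hb he hv hlt => (hP m Y hb).mono le_rfl ?_⟩
    rintro m' rfl
    rw [eval_regE h0, hv]
    exact ⟨by simp [reg_update], he.update le_rfl _, hb.update _ hlt⟩
  have lift : ∀ {w : List ℕ} {s : ArrState} {e : Ex} {ρ : ℕ → ℕ} {Z Y : ℕ}, Small w s Z →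
      (∀ n, ρ n < w.length + 2) → e.bits.eval Z ≤ Y → e.eval w s ρ < 2 ^ Y :=
    fun hs hρ hY => (Ex.eval_lt hs _ _ hρ).trans_le (Nat.pow_le_pow_right (by norm_num) hY)
  induction e with
  | const n =>
    intro loc d
    obtain ⟨P, hP⟩ := simple d (.const n)
    refine ⟨P, fun w s m ρ Z Y hs hm hρ hZ hY hb => ?_⟩
    exact hP _ _ m m Y hm.len hb (.refl _ _ _) rfl (lift (e := .const n) hs (fun n => (hρ n).2.2) hY)
  | var n =>
    intro loc d
    obtain ⟨P, hP⟩ := simple d (getE (loc n))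
    refine ⟨P, fun w s m ρ Z Y hs hm hρ hZ hY hb => ?_⟩
    refine hP _ _ m m Y hm.len hb (.refl _ _ _) ?_
      (lift (e := .var n) hs (fun n => (hρ n).2.2) hY)
    rw [eval_getE hm.len, (hρ n).2.1]; rfl
  | len =>
    intro loc d
    obtain ⟨P, hP⟩ := simple d (.add (.load (.const 0)) (.const 2))
    refine ⟨P, fun w s m ρ Z Y hs hm hρ hZ hY hb => ?_⟩
    refine hP _ _ m m Y hm.len hb (.refl _ _ _) ?_ (lift (e := .len) hs (fun n => (hρ n).2.2) hY)
    simp [Expr.eval, Ex.eval, hm.len]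
  | inp n =>
    intro loc d
    obtain ⟨P, hP⟩ := simple d (.load (.add (getE (loc n)) (.const 1)))
    refine ⟨P, fun w s m ρ Z Y hs hm hρ hZ hY hb => ?_⟩
    refine hP _ _ m m Y hm.len hb (.refl _ _ _) ?_
      (lift (e := .inp n) hs (fun n => (hρ n).2.2) hY)
    simp only [Expr.eval, Ex.eval, eval_getE hm.len, (hρ n).2.1]
    exact hm.inp _ (hρ n).2.2
  | arr a e ih =>
    intro loc d
    obtain ⟨P₁, h₁⟩ := ih loc d
    obtain ⟨P, hP⟩ := simple d (.load (cellE a (getE d)))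
    refine ⟨P₁ + P, fun w s m ρ Z Y hs hm hρ hZ hY hb => ?_⟩
    rw [eval_add]
    refine (h₁ w s m ρ Z Y hs hm hρ hZ ?_ hb).seq ?_
    · simp only [Ex.bits, eval_add, eval_X] at hY; omega
    · rintro m₁ ⟨hr, he, hb₁⟩
      have hm₁ := he.represents hm
      refine hP _ _ m₁ m Y hm₁.len hb₁ he ?_
        (lift (e := .arr a e) hs (fun n => (hρ n).2.2) hY)
      simp only [Expr.eval, eval_cellE hm₁.len, eval_getE hm₁.len, hr, hm₁.arr, Ex.eval]
  | bin o e₁ e₂ ih₁ ih₂ =>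
    intro loc d
    obtain ⟨P₁, h₁⟩ := ih₁ loc d
    obtain ⟨P₂, h₂⟩ := ih₂ loc (d + 1)
    obtain ⟨P, hP⟩ := simple d (o.expr (getE d) (getE (d + 1)))
    refine ⟨P₁ + (P₂ + P), fun w s m ρ Z Y hs hm hρ hZ hY hb => ?_⟩
    have hY' := hY
    simp only [Ex.bits, eval_add, eval_one] at hY'
    rw [eval_add, eval_add]
    refine (h₁ w s m ρ Z Y hs hm hρ hZ (by omega) hb).seq ?_
    rintro m₁ ⟨hr₁, he₁, hb₁⟩
    have hm₁ := he₁.represents hm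
    refine (h₂ w s m₁ ρ Z Y hs hm₁ (fun n => ⟨(hρ n).1.trans (Nat.lt_succ_self d), ?_,
      (hρ n).2.2⟩) hZ (by omega) hb₁).seq ?_
    · rw [he₁.reg (hρ n).1, (hρ n).2.1]
    rintro m₂ ⟨hr₂, he₂, hb₂⟩
    have hm₂ := he₂.represents hm₁
    refine hP _ _ m₂ m Y hm₂.len hb₂ (he₁.trans (he₂.mono (by omega))) ?_
      (lift (e := .bin o e₁ e₂) hs (fun n => (hρ n).2.2) hY)
    simp only [Op.eval_expr, eval_getE hm₂.len, hr₂, he₂.reg (Nat.lt_succ_self d), hr₁, Ex.eval]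
  | agg p e ih =>
    intro loc d
    obtain ⟨P₀, h₀⟩ := simple d (.const (bif p then 1 else 0))
    obtain ⟨P₁, h₁⟩ := ih (push (d + 1) loc) (d + 2)
    obtain ⟨P₂, h₂⟩ := exists_haltsWith_store (regE d)
      ((bif p then Op.mul else Op.add).expr (getE d) (getE (d + 2)))
    obtain ⟨P₃, h₃⟩ := exists_haltsWith_forLoop (d + 1)
    refine ⟨P₀ + (P₃ + (P₁ + P₂)) * (X + 1), fun w s m ρ Z Y hs hm hρ hZ hY hb => ?_⟩
    have hY' := hY
    simp only [Ex.bits, eval_add, eval_one, eval_mul, eval_X] at hY'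
    have hZpos : 2 ≤ Z := by have := hs.len; omega
    have hpush : ∀ i < w.length + 2, ∀ n, push i ρ n < w.length + 2 := by
      rintro i hi (_ | n)
      · exact hi
      · exact (hρ n).2.2
    -- The accumulator also stores the partial sums or products, so these must fit into `Y` bits as
    -- well.
    have hpart : ∀ i ≤ w.length + 2,
        aggregate p i (fun j => e.eval w s (push j ρ)) < 2 ^ Y := by
      intro i hi
      refine (aggregate_lt (Z := Z) (b := e.bits.eval Z) (hi.trans hs.len) fun j hj => ?_).trans_le
        (Nat.pow_le_pow_right (by norm_num) hY')
      exact Ex.eval_lt hs e _ (hpush j (by omega))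
    simp only [eval_add, eval_mul, eval_X, eval_one]
    refine (h₀ w.length (bif p then 1 else 0) m m Y hm.len hb (.refl _ _ _) rfl ?_).seq ?_
    · have := hpart 0 (by omega)
      cases p <;> simp_all [aggregate]
    rintro m₀ ⟨hr₀, he₀, hb₀⟩
    refine (h₃ _ w.length (P₁.eval Y + P₂.eval Y) Y (fun i m' => EqBelow w.length d m m' ∧ m'.Bdd Y ∧
      m'.reg w.length d = aggregate p i (fun j => e.eval w s (push j ρ)))
      (hs.len.trans hZ) ?_ ?_ ?_ m₀ ⟨he₀, hb₀, ?_⟩).mono le_rfl ?_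
    · rintro i m' ⟨h, h', -⟩
      exact ⟨(h.represents hm).len, h'⟩
    · rintro i m' v ⟨h, h', h''⟩ hv
      exact ⟨h.update (by omega) _, h'.update _ hv, by simp [reg_update, h'']⟩
    · rintro i hi m' ⟨h, h', h''⟩ hi'
      refine (h₁ w s m' (push i ρ) Z Y hs (h.represents hm) ?_ hZ ?_ h').seq ?_
      · rintro (_ | n)
        · exact ⟨by simp, hi', hi⟩
        · refine ⟨(hρ n).1.trans (by omega), ?_, (hρ n).2.2⟩
          simp only [push_succ]
          rw [h.reg (hρ n).1, (hρ n).2.1]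
      · nlinarith
      rintro m₁ ⟨hr₁, he₁, hb₁⟩
      have hm₁ := he₁.represents (h.represents hm)
      refine (h₂ m₁ Y hb₁).mono le_rfl ?_
      rintro m₂ rfl
      simp only [eval_regE hm₁.len, Op.eval_expr, eval_getE hm₁.len, hr₁,
        he₁.reg (show d < d + 2 by omega), h'', ← aggregate_succ]
      refine ⟨?_, (h.trans (he₁.mono (by omega))).update le_rfl _, hb₁.update _ (hpart _ hi),
        by simp [reg_update]⟩
      simp [reg_update, he₁.reg (show d + 1 < d + 2 by omega), hi']
    · rw [hr₀]
      cases p <;> simp [aggregate]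
    · rintro m' ⟨h, h', h''⟩
      exact ⟨h'', h, h'⟩

end RAM

namespace RAM

open Polynomial

/-! ### Array programs -/

/-- The number `2 ^ len ^ D` as an expression. -/
def Ex.bound : ℕ → Ex
  | 0 => .const 2
  | D + 1 => .agg true (bound D)

theorem Ex.eval_bound (w : List ℕ) (s : ArrState) (D : ℕ) : ∀ ρ : ℕ → ℕ,
    (Ex.bound D).eval w s ρ = 2 ^ (w.length + 2) ^ D := by
  induction D with
  | zero => intro ρ; simp [Ex.bound, Ex.eval]
  | succ D ih => intro ρ; simp [Ex.bound, Ex.eval, ih, aggregate, pow_succ, pow_mul]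

/-- The minimum of an expression and `2 ^ len ^ 5`. -/
def Ex.clamp (e : Ex) : Ex := .bin .sub e (.bin .sub e (.bound 5))

theorem Ex.eval_clamp (w : List ℕ) (s : ArrState) (ρ : ℕ → ℕ) (e : Ex) :
    e.clamp.eval w s ρ = min (e.eval w s ρ) (2 ^ (w.length + 2) ^ 5) := by
  simp only [Ex.clamp, Ex.eval, Op.eval, Ex.eval_bound]
  generalize 2 ^ (w.length + 2) ^ 5 = b
  omega

/-- Array programs: `assign a e` sets the entry `i` of the array `a` to the value of `e` at `i`,
truncated at `2 ^ len ^ 5`, simultaneously for all `i < len`, and `rep p` executes `p` `len`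
times. -/
inductive Stmt where
  | assign (a : Fin 14) (e : Ex)
  | seq (p q : Stmt)
  | rep (p : Stmt)

/-- The effect of an array program. -/
def Stmt.exec (w : List ℕ) : Stmt → ArrState → ArrState
  | .assign a e, s => fun b i => if b = a ∧ i < w.length + 2 then
      min (e.eval w s fun _ => i) (2 ^ (w.length + 2) ^ 5) else s b i
  | .seq p q, s => q.exec w (p.exec w s)
  | .rep p, s => (p.exec w)^[w.length + 2] s

/-- The machine program for an array program; it uses the registers from `d` on. -/
def Stmt.compile : Stmt → ℕ → Program
  | .assign a e, d => .seq
      -- The new values go to the buffer array `14` first, because `e` may read entries of `a` that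
      -- would otherwise already be overwritten.
      (forLoop d (.seq (e.clamp.compile (fun _ => d) (d + 1))
        (.store (cellE 14 (getE d)) (getE (d + 1)))))
      (forLoop d (.store (cellE a (getE d)) (.load (cellE 14 (getE d)))))
  | .seq p q, d => .seq (p.compile d) (q.compile d)
  | .rep p, d => forLoop d (p.compile (d + 1))

/-- This is the purpose of the truncation: without it, repeated squaring in a loop would produce
numbers of exponential bit length. -/
theorem Small.exec {w : List ℕ} {Z : ℕ} (hZ : (w.length + 2) ^ 5 < Z) (p : Stmt) :
    ∀ {s : ArrState}, Small w s Z → Small w (p.exec w s) Z := by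
  induction p with
  | assign a e =>
    intro s hs
    refine ⟨hs.len, hs.inp, fun b i => ?_⟩
    simp only [Stmt.exec]
    split
    · exact (min_le_right _ _).trans_lt (Nat.pow_lt_pow_right (by norm_num) hZ)
    · exact hs.arr _ _
  | seq p q hp hq => intro s hs; exact hq (hp hs)
  | rep p hp =>
    intro s hs
    simp only [Stmt.exec]
    generalize w.length + 2 = n
    induction n with
    | zero => exact hs
    | succ n ih => rw [Function.iterate_succ_apply']; exact hp ih

theorem Represents.update_of_le {w : List ℕ} {s : ArrState} {m : Memory} (h : Represents w s m)
    {a : ℕ} (ha : 14 ≤ a) (ha' : a < 16) (i v : ℕ) :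
    Represents w s (Function.update m (addr w.length a i) v) where
  len := by rw [Function.update_of_ne (addr_ne_input (by omega)), h.len]
  inp j hj := by rw [Function.update_of_ne (addr_ne_input (by omega)), h.inp j hj]
  arr b j := by
    rw [Function.update_of_ne, h.arr]
    rw [Ne, addr_inj (by omega) ha']; omega

theorem Represents.update {w : List ℕ} {s : ArrState} {m : Memory} (h : Represents w s m)
    (a : Fin 14) (i v : ℕ) :
    Represents w (fun b j => if b = a ∧ j = i then v else s b j)
      (Function.update m (addr w.length a i) v) where
  len := by rw [Function.update_of_ne (addr_ne_input (by omega)), h.len]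
  inp j hj := by rw [Function.update_of_ne (addr_ne_input (by omega)), h.inp j hj]
  arr b j := by
    split
    · next hb => rw [hb.1, hb.2, Function.update_self]
    · next hb =>
      rw [Function.update_of_ne, h.arr]
      rw [Ne, addr_inj (by omega) (by omega)]
      rintro ⟨h₁, h₂⟩
      exact hb ⟨Fin.ext h₁, h₂⟩

theorem reg_update_of_lt {m : Memory} {L a i v d : ℕ} (ha : a < 15) :
    Memory.reg (Function.update m (addr L a i) v) L d = m.reg L d := by
  unfold Memory.reg
  rw [Function.update_of_ne]
  rw [Ne, addr_inj (by norm_num) (by omega)]; omega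

/-- The polynomial `B` bounds the bits of the clamped expressions in `p`. Because execution
preserves `Small w s Z`, one choice of `Z` and `Y` serves all rounds of all loops, and nested loops
only multiply the time by polynomial factors. -/
theorem Stmt.exists_haltsWith_compile (p : Stmt) : ∀ d : ℕ, ∃ P B : ℕ[X],
    ∀ (w : List ℕ) (s : ArrState) (m : Memory) (Z Y : ℕ), Small w s Z →
    (w.length + 2) ^ 5 < Z → Represents w s m → Z ≤ Y → B.eval Z ≤ Y → m.Bdd Y →
    HaltsWith (p.compile d) m (P.eval Y) fun m' => Represents w (p.exec w s) m' ∧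
      (∀ d' < d, m'.reg w.length d' = m.reg w.length d') ∧ m'.Bdd Y := by
  induction p with
  | assign a e =>
    intro d
    obtain ⟨P₁, h₁⟩ := Ex.exists_haltsWith_compile e.clamp (fun _ => d) (d + 1)
    obtain ⟨P₂, h₂⟩ := exists_haltsWith_store (cellE 14 (getE d)) (getE (d + 1))
    obtain ⟨P₃, h₃⟩ := exists_haltsWith_store (cellE a (getE d)) (.load (cellE 14 (getE d)))
    obtain ⟨P₄, h₄⟩ := exists_haltsWith_forLoop d
    refine ⟨(P₄ + (P₁ + P₂)) * (X + 1) + (P₄ + P₃) * (X + 1), e.clamp.bits,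
      fun w s m Z Y hs hKZ hm hZ hY hb => ?_⟩
    have hLY : w.length + 2 ≤ Y := hs.len.trans hZ
    set val : ℕ → ℕ := fun i => min (e.eval w s fun _ => i) (2 ^ (w.length + 2) ^ 5) with hval
    have hvalY : ∀ i, val i < 2 ^ Y := fun i => (min_le_right _ _).trans_lt
      (Nat.pow_lt_pow_right (by norm_num) (hKZ.trans_le hZ))
    simp only [eval_add, eval_mul, eval_X, eval_one]
    refine HaltsWith.seq (h₄ _ w.length (P₁.eval Y + P₂.eval Y) Y
      (fun i m' => Represents w s m' ∧ (∀ d' < d, m'.reg w.length d' = m.reg w.length d') ∧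
        m'.Bdd Y ∧ ∀ j < i, m' (addr w.length 14 j) = val j) hLY ?_ ?_ ?_ m
      ⟨hm, fun _ _ => rfl, hb, by simp⟩) ?_
    · rintro i m' ⟨h, -, h', -⟩
      exact ⟨h.len, h'⟩
    · rintro i m' v ⟨r, hr, hb', hv⟩ hlt
      refine ⟨r.update_of_le (by norm_num) (by norm_num) _ _, fun d' hd' => ?_, hb'.update _ hlt,
        fun j hj => ?_⟩
      · rw [reg_update, if_neg hd'.ne, hr d' hd']
      · rw [Function.update_of_ne, hv j hj]
        rw [Ne, addr_inj (by norm_num) (by norm_num)]; omega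
    · rintro i hi m' ⟨r, hr, hb', hv⟩ hi'
      refine (h₁ w s m' (fun _ => i) Z Y hs r (fun n => ⟨Nat.lt_succ_self d, hi', hi⟩) hZ hY
        hb').seq ?_
      rintro m₁ ⟨hr₁, he₁, hb₁⟩
      have r₁ := he₁.represents r
      refine (h₂ m₁ Y hb₁).mono le_rfl ?_
      rintro m₂ rfl
      have hd : m₁.reg w.length d = i := by rw [he₁.reg (Nat.lt_succ_self d), hi']
      simp only [eval_cellE r₁.len, eval_getE r₁.len, hd, hr₁, Ex.eval_clamp]
      refine ⟨by rw [reg_update_of_lt (by norm_num), hd],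
        r₁.update_of_le le_rfl (by norm_num) _ _, fun d' hd' => ?_, hb₁.update _ (hvalY i),
        fun j hj => ?_⟩
      · rw [reg_update_of_lt (by norm_num), he₁.reg (by omega), hr d' hd']
      · by_cases hji : j = i
        · subst hji; simp [hval]
        · rw [Function.update_of_ne, he₁ _, hv j (by omega)]
          · intro d' _; rw [Ne, addr_inj (by norm_num) (by norm_num)]; omega
          · rw [Ne, addr_inj (by norm_num) (by norm_num)]; omega
    · rintro m' ⟨r, hr, hb', hv⟩
      refine (h₄ _ w.length (P₃.eval Y) Y
        (fun i m' => Represents w (fun b j => if b = a ∧ j < i then val j else s b j) m' ∧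
          (∀ d' < d, m'.reg w.length d' = m.reg w.length d') ∧ m'.Bdd Y ∧
          ∀ j < w.length + 2, m' (addr w.length 14 j) = val j) hLY ?_ ?_ ?_ m'
        ⟨by simpa using r, hr, hb', hv⟩).mono le_rfl ?_
      · rintro i m' ⟨h, -, h', -⟩
        exact ⟨h.len, h'⟩
      · rintro i m' v ⟨r, hr, hb', hv⟩ hlt
        refine ⟨r.update_of_le (by norm_num) (by norm_num) _ _, fun d' hd' => ?_, hb'.update _ hlt,
          fun j hj => ?_⟩
        · rw [reg_update, if_neg hd'.ne, hr d' hd']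
        · rw [Function.update_of_ne, hv j hj]
          rw [Ne, addr_inj (by norm_num) (by norm_num)]; omega
      · rintro i hi m' ⟨r, hr, hb', hv⟩ hi'
        refine (h₃ m' Y hb').mono le_rfl ?_
        rintro m₂ rfl
        simp only [eval_cellE r.len, eval_getE r.len, hi', Expr.eval, hv i hi]
        refine ⟨by rw [reg_update_of_lt (by omega), hi'], ?_, fun d' hd' => ?_,
          hb'.update _ (hvalY i), fun j hj => ?_⟩
        · convert r.update a i (val i) using 3 with b j
          by_cases h : b = a <;> by_cases h' : j = i <;> simp [h, h']
          congr 1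
          exact propext (by omega)
        · rw [reg_update_of_lt (by omega), hr d' hd']
        · rw [Function.update_of_ne, hv j hj]
          rw [Ne, addr_inj (by norm_num) (by omega)]; omega
      · rintro m' ⟨r, hr, hb', hv⟩
        exact ⟨r, hr, hb'⟩
  | seq p q ihp ihq =>
    intro d
    obtain ⟨P₁, B₁, h₁⟩ := ihp d
    obtain ⟨P₂, B₂, h₂⟩ := ihq d
    refine ⟨P₁ + P₂, B₁ + B₂, fun w s m Z Y hs hKZ hm hZ hY hb => ?_⟩
    rw [eval_add] at hY
    rw [eval_add]
    refine (h₁ w s m Z Y hs hKZ hm hZ (by omega) hb).seq ?_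
    rintro m₁ ⟨r₁, hr₁, hb₁⟩
    refine (h₂ w _ m₁ Z Y (hs.exec hKZ p) hKZ r₁ hZ (by omega) hb₁).mono le_rfl ?_
    rintro m₂ ⟨r₂, hr₂, hb₂⟩
    exact ⟨r₂, fun d' hd' => (hr₂ d' hd').trans (hr₁ d' hd'), hb₂⟩
  | rep p ih =>
    intro d
    obtain ⟨P₁, B₁, h₁⟩ := ih (d + 1)
    obtain ⟨P₂, h₂⟩ := exists_haltsWith_forLoop d
    refine ⟨(P₂ + P₁) * (X + 1), B₁, fun w s m Z Y hs hKZ hm hZ hY hb => ?_⟩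
    simp only [eval_add, eval_mul, eval_X, eval_one]
    have hsm : ∀ i, Small w ((p.exec w)^[i] s) Z := by
      intro i
      induction i with
      | zero => exact hs
      | succ n ih => rw [Function.iterate_succ_apply']; exact ih.exec hKZ p
    refine h₂ _ w.length (P₁.eval Y) Y (fun i m' => Represents w ((p.exec w)^[i] s) m' ∧
      (∀ d' < d, m'.reg w.length d' = m.reg w.length d') ∧ m'.Bdd Y) (hs.len.trans hZ) ?_ ?_ ?_ m
      ⟨hm, fun _ _ => rfl, hb⟩
    · rintro i m' ⟨h, -, h'⟩
      exact ⟨h.len, h'⟩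
    · rintro i m' v ⟨r, hr, hb'⟩ hlt
      refine ⟨r.update_of_le (by norm_num) (by norm_num) _ _, fun d' hd' => ?_, hb'.update _ hlt⟩
      rw [reg_update, if_neg hd'.ne, hr d' hd']
    · rintro i hi m' ⟨r, hr, hb'⟩ hi'
      refine (h₁ w _ m' Z Y (hsm i) hKZ r hZ hY hb').mono le_rfl ?_
      rintro m₁ ⟨r₁, hr₁, hb₁⟩
      refine ⟨by rw [hr₁ d (by omega), hi'], ?_, fun d' hd' => ?_, hb₁⟩
      · rwa [Function.iterate_succ_apply']
      · rw [hr₁ d' (by omega), hr d' hd']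

/-! ### From array programs to polynomial-time computability -/

theorem le_bitLength {w : List ℕ} {v : ℕ} (h : v ∈ w) : logCost v ≤ bitLength w :=
  List.single_le_sum (by simp) _ (List.mem_map_of_mem h)

theorem length_le_bitLength (w : List ℕ) : w.length ≤ bitLength w := by
  induction w with
  | nil => simp
  | cons v w ih =>
    simp only [bitLength, List.map_cons, List.sum_cons, List.length_cons, logCost] at *
    omega

theorem getD_lt (w : List ℕ) (i : ℕ) : w.getD i 0 < 2 ^ bitLength w := by
  by_cases hi : i < w.length
  · rw [List.getD_eq_getElem _ _ hi]
    have := le_bitLength (List.getElem_mem hi)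
    exact Nat.size_le.1 (by unfold logCost at this; omega)
  · rw [List.getD_eq_default _ _ (by omega)]
    positivity

theorem represents_initMemory (w : List ℕ) : Represents w (fun _ _ => 0) (initMemory w) where
  len := rfl
  inp i _ := rfl
  arr a i := by
    unfold initMemory addr
    rw [List.getD_eq_default]
    simp only [List.length_cons]; omega

/-- A function that is computed by an array program is computable in polynomial time. -/
theorem polyTimeComputableOn_of_exec {T : Type} {encode : T → List ℕ} {S : Set T} {f : T → ℕ}
    (p : Stmt) (hp : ∀ x ∈ S, p.exec (encode x) (fun _ _ => 0) 0 0 = f x) :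
    PolyTimeComputableOn encode S f := by
  obtain ⟨P, B, h⟩ := p.exists_haltsWith_compile 0
  obtain ⟨P', h'⟩ := exists_haltsWith_store (.const 0) (.load (cellE 0 (.const 0)))
  -- A bound, in terms of the bit length of the input, for the truncation exponent `len ^ 5`, the
  -- input entries and `len` at once.
  set Zp : ℕ[X] := (X + 2) ^ 5 + X + 3 with hZp
  -- The result is moved to cell `0` at the very end only, since all addresses are computed from the
  -- length stored there.
  refine ⟨.seq (p.compile 0) (.store (.const 0) (.load (cellE 0 (.const 0)))),
    (P + P').comp (Zp + B.comp Zp), fun x hx => ?_⟩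
  set w := encode x
  set Z := Zp.eval (bitLength w) with hZ
  have hZ' : Z = (bitLength w + 2) ^ 5 + bitLength w + 3 := by simp [hZ, hZp]
  have hlen := length_le_bitLength w
  have hpow : (w.length + 2) ^ 5 ≤ (bitLength w + 2) ^ 5 := Nat.pow_le_pow_left (by omega) 5
  have hs : Small w (fun _ _ => 0) Z := by
    refine ⟨by omega, fun i => ?_, fun _ _ => by positivity⟩
    exact (getD_lt w i).trans_le (Nat.pow_le_pow_right (by norm_num) (by omega))
  set Y := Z + B.eval Z with hY
  have hb : (initMemory w).Bdd Y := by
    have hle : 2 ^ bitLength w ≤ 2 ^ Y := Nat.pow_le_pow_right (by norm_num) (by omega)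
    rintro (_ | i)
    · have : Y < 2 ^ Y := Nat.lt_two_pow_self
      simp only [initMemory, List.getD_cons_zero]; omega
    · exact (getD_lt w i).trans_le hle
  have := (h w _ _ Z Y hs (by omega) (represents_initMemory w) (by omega) (by omega) hb).seq
    (q := .store (.const 0) (.load (cellE 0 (.const 0)))) (T' := P'.eval Y) (Q' := fun m => m 0 = f x) fun m hm => ?_
  · obtain ⟨t, m, h₁, h₂, h₃⟩ := this
    refine ⟨t, m, h₁, h₂.trans (le_of_eq ?_), h₃⟩
    simp only [eval_comp, eval_add, hY, hZ]
  · refine (h' m Y hm.2.2).mono le_rfl ?_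
    rintro m' rfl
    have := hm.1.arr 0 0
    simp only [Fin.val_zero] at this
    simp only [Expr.eval, eval_cellE hm.1.len, this, Function.update_self]
    exact hp x hx

end RAM

/-! ### Weighted clauses along an elimination order -/

/-- A system of `K` weighted clauses with variables `0, …, K - 1`. The clause `i` contains the
variables `l` with `has i l`, is falsified by the assignments that map them to `fval i l`, and
contributes the factor `base i` when it is falsified. The variables are eliminated in increasing
order; `nest` says that `k` is a nest point when it is eliminated. The clauses are ranked
compatibly with this order. -/
structure ClauseSystem where
  K : ℕ
  has : ℕ → ℕ → Prop
  fval : ℕ → ℕ → Bool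
  rank : ℕ → ℕ
  base : ℕ → ℕ
  base_pos : ∀ i, 0 < base i
  rank_inj : ∀ i < K, ∀ j < K, rank i = rank j → i = j
  nest : ∀ k, ∀ i < K, ∀ j < K, has i k → has j k →
    (∀ l, k < l → has i l → has j l) ∨ (∀ l, k < l → has j l → has i l)
  rank_lt : ∀ k, ∀ i < K, ∀ j < K, (∀ l, k < l → has i l → has j l) →
    (∃ l, k < l ∧ has j l ∧ ¬ has i l) → rank i < rank j

namespace ClauseSystem

open Finset
open scoped Classical

variable (S : ClauseSystem)

/-- The assignment `a` falsifies the part of the clause `i` on the variables from `k` on. -/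
def Falsified (k i : ℕ) (a : ℕ → Bool) : Prop := ∀ l, k ≤ l → S.has i l → a l = S.fval i l

/-- The variable `k` occurs in some clause. -/
def Used (k : ℕ) : Prop := ∃ i < S.K, S.has i k

/-- The clause `j` contains `k` and is subsumed by the clause `i` on the variables above `k`. -/
def Subsumed (k j i : ℕ) : Prop :=
  S.has j k ∧ ∀ l, k < l → S.has j l → S.has i l ∧ S.fval i l = S.fval j l

/-- The clauses of smaller rank that are subsumed by `i` when the variable `k` is eliminated. -/
noncomputable def below (k i : ℕ) : Finset ℕ :=
  (range S.K).filter fun j => S.rank j < S.rank i ∧ S.Subsumed k j i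

/-- The sum over both values of `k` of the product of the weights of the clauses in `J` that are
falsified by this value. -/
noncomputable def split (w : ℕ → ℚ) (k : ℕ) (J : Finset ℕ) : ℚ :=
  ∏ j ∈ J with S.fval j k = false, w j + ∏ j ∈ J with S.fval j k = true, w j

/-- The weights of the clauses after the elimination of the variables below `k`. -/
noncomputable def weight : ℕ → ℕ → ℚ
  | 0, i => S.base i
  | k + 1, i => if S.has i k then
      S.split (weight k) k (insert i (S.below k i)) / S.split (weight k) k (S.below k i)
    else weight k i

/-- The weighted number of extensions of an assignment of the variables from `k` on, for the clauses
of rank less than `r`. -/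
noncomputable def count (r : ℕ) : ℕ → (ℕ → Bool) → ℕ
  | 0, a => ∏ j ∈ range S.K with S.rank j < r ∧ S.Falsified 0 j a, S.base j
  | k + 1, a => if S.Used k then
      count r k (Function.update a k false) + count r k (Function.update a k true)
    else count r k a

variable {S}

theorem split_pos {w : ℕ → ℚ} (hw : ∀ j, 0 < w j) (k : ℕ) (J : Finset ℕ) : 0 < S.split w k J :=
  add_pos (prod_pos fun _ _ => hw _) (prod_pos fun _ _ => hw _)

variable (S) in
theorem weight_pos (k : ℕ) : ∀ i, 0 < S.weight k i := by
  induction k with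
  | zero =>
    intro i
    rw [weight]
    exact_mod_cast S.base_pos i
  | succ k ih =>
    intro i
    unfold weight
    split
    · exact div_pos (split_pos ih _ _) (split_pos ih _ _)
    · exact ih i

/-- The left side does not mention `a`, which is why the new weight of `i` is a number and not a
function of the assignment. For the converse, the nest condition makes `i` and `j` comparable above
`k`, the smaller rank of `j` rules out that `j` is strictly larger there, and both clauses agree
with `a`. -/
theorem mem_below_iff {k i j : ℕ} {a : ℕ → Bool} (hi : i < S.K) (hk : S.has i k)
    (ha : S.Falsified (k + 1) i a) : j ∈ S.below k i ↔
      j ∈ range S.K ∧ S.rank j < S.rank i ∧ S.has j k ∧ S.Falsified (k + 1) j a := by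
  rw [below, mem_filter, mem_range]
  refine and_congr_right fun hj => and_congr_right fun hr => and_congr_right fun hjk => ?_
  constructor
  · intro h l hl hjl
    rw [← (h l hl hjl).2]
    exact ha l hl (h l hl hjl).1
  · intro h
    have hsub : ∀ l, k < l → S.has j l → S.has i l := by
      rcases S.nest k j hj i hi hjk hk with h' | h'
      · exact h'
      · by_contra hne
        push Not at hne
        obtain ⟨l, hl, hjl, hil⟩ := hne
        exact absurd (S.rank_lt k i hi j hj h' ⟨l, hl, hjl, hil⟩) (by omega)
    intro l hl hjl
    exact ⟨hsub l hl hjl, by rw [← ha l hl (hsub l hl hjl), h l hl hjl]⟩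

/-- Telescoping along the rank. Raising `r` by one adds at most one clause `i`, the clauses already
present are `below k i`, and the new weight of `i` is by definition the quotient of the two values
of `split`. The factor `2` is `split` of the empty set. -/
theorem split_eq_two_mul_prod (k r : ℕ) (a : ℕ → Bool) :
    S.split (S.weight k) k
        {j ∈ range S.K | S.rank j < r ∧ S.has j k ∧ S.Falsified (k + 1) j a} =
      2 * ∏ j ∈ range S.K with S.rank j < r ∧ S.has j k ∧ S.Falsified (k + 1) j a,
        S.weight (k + 1) j := by
  induction r with
  | zero => simp [split]; norm_num
  | succ r ih =>
    by_cases h : ∃ i < S.K, S.rank i = r ∧ S.has i k ∧ S.Falsified (k + 1) i a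
    · obtain ⟨i, hi, rfl, hik, hia⟩ := h
      have hb : S.below k i =
          {j ∈ range S.K | S.rank j < S.rank i ∧ S.has j k ∧ S.Falsified (k + 1) j a} := by
        ext j
        rw [mem_below_iff hi hik hia, mem_filter]
      have hins : {j ∈ range S.K | S.rank j < S.rank i + 1 ∧ S.has j k ∧ S.Falsified (k + 1) j a}
          = insert i (S.below k i) := by
        rw [hb]
        ext j
        simp only [mem_filter, mem_range, mem_insert]
        constructor
        · rintro ⟨h₁, h₂, h₃⟩
          by_cases h : S.rank j = S.rank i
          · exact .inl (S.rank_inj j h₁ i hi h)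
          · exact .inr ⟨h₁, by omega, h₃⟩
        · rintro (rfl | ⟨h₁, h₂, h₃⟩)
          · exact ⟨hi, by omega, hik, hia⟩
          · exact ⟨h₁, by omega, h₃⟩
      have hni : i ∉ S.below k i := by simp [below]
      rw [← hb] at ih
      rw [hins, prod_insert hni, mul_left_comm, ← ih]
      have := (split_pos (S := S) (S.weight_pos k) k (S.below k i)).ne'
      simp only [weight, hik, if_true]
      field_simp
    · have : {j ∈ range S.K | S.rank j < r + 1 ∧ S.has j k ∧ S.Falsified (k + 1) j a} =
          {j ∈ range S.K | S.rank j < r ∧ S.has j k ∧ S.Falsified (k + 1) j a} := by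
        refine filter_congr fun j hj => and_congr_left fun hj' => ?_
        have : S.rank j ≠ r := fun hr => h ⟨j, mem_range.1 hj, hr, hj'⟩
        omega
      rw [this, ih]

theorem falsified_update {k i : ℕ} {a : ℕ → Bool} {b : Bool} :
    S.Falsified k i (Function.update a k b) ↔
      S.Falsified (k + 1) i a ∧ (S.has i k → S.fval i k = b) := by
  constructor
  · intro h
    refine ⟨fun l hl hil => ?_, fun hik => by simpa using (h k le_rfl hik).symm⟩
    have := h l (by omega) hil
    rwa [Function.update_of_ne (by omega)] at this
  · rintro ⟨h, h'⟩ l hl hil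
    by_cases hlk : l = k
    · subst hlk; simpa using (h' hil).symm
    · rw [Function.update_of_ne hlk]; exact h l (by omega) hil

theorem count_eq (r k : ℕ) : ∀ a : ℕ → Bool, (S.count r k a : ℚ) =
    2 ^ #{l ∈ range k | S.Used l} *
      ∏ j ∈ range S.K with S.rank j < r ∧ S.Falsified k j a, S.weight k j := by
  induction k with
  | zero => intro a; simp [count, weight]
  | succ k ih =>
    intro a
    unfold count
    split
    · next hk =>
      -- The clauses in `A` do not contain `k`: they keep their weight and factor out of both
      -- summands. The clauses in `B` contain `k` and are handled by the telescoping identity.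
      set A := {j ∈ range S.K | S.rank j < r ∧ ¬ S.has j k ∧ S.Falsified (k + 1) j a} with hA
      set B := {j ∈ range S.K | S.rank j < r ∧ S.has j k ∧ S.Falsified (k + 1) j a} with hB
      have hdisj : Disjoint A B := by
        rw [disjoint_left]; intro j h₁ h₂
        exact (mem_filter.1 h₁).2.2.1 (mem_filter.1 h₂).2.2.1
      have hside : ∀ b : Bool, ∏ j ∈ range S.K with
          S.rank j < r ∧ S.Falsified k j (Function.update a k b), S.weight k j =
          (∏ j ∈ A, S.weight k j) * ∏ j ∈ B with S.fval j k = b, S.weight k j := by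
        intro b
        rw [← prod_union (hdisj.mono_right (filter_subset _ _))]
        refine prod_congr ?_ fun _ _ => rfl
        ext j
        simp only [hA, hB, mem_filter, mem_union, falsified_update]
        tauto
      have hall : ∏ j ∈ range S.K with S.rank j < r ∧ S.Falsified (k + 1) j a,
          S.weight (k + 1) j = (∏ j ∈ A, S.weight k j) * ∏ j ∈ B, S.weight (k + 1) j := by
        have : {j ∈ range S.K | S.rank j < r ∧ S.Falsified (k + 1) j a} = A ∪ B := by
          ext j
          simp only [hA, hB, mem_filter, mem_union]
          tauto
        rw [this, prod_union hdisj]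
        congr 1
        refine prod_congr rfl fun j hj => ?_
        simp [weight, (mem_filter.1 hj).2.2.1]
      have hcard : #{l ∈ range (k + 1) | S.Used l} = #{l ∈ range k | S.Used l} + 1 := by
        rw [range_add_one, filter_insert, if_pos hk, card_insert_of_notMem (by simp)]
      have hsplit := split_eq_two_mul_prod (S := S) k r a
      rw [← hB, split] at hsplit
      push_cast
      rw [ih, ih, hside, hside, hall, hcard, pow_succ, ← mul_add, ← mul_add, hsplit]
      ring
    · next hk =>
      have hno : ∀ j ∈ range S.K, ¬ S.has j k := fun j hj h => hk ⟨j, mem_range.1 hj, h⟩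
      have hcard : {l ∈ range (k + 1) | S.Used l} = {l ∈ range k | S.Used l} := by
        rw [range_add_one, filter_insert, if_neg hk]
      rw [ih, hcard]
      congr 1
      refine prod_congr (filter_congr fun j hj => and_congr_right fun _ => ?_) fun j hj => ?_
      · refine ⟨fun h l hl => h l (by omega), fun h l hl hjl => ?_⟩
        rcases hl.eq_or_lt with rfl | hl
        · exact absurd hjl (hno j hj)
        · exact h l hl hjl
      · simp [weight, hno j (mem_filter.1 hj).1]

theorem count_pos (r k : ℕ) : ∀ a, 0 < S.count r k a := by
  induction k with
  | zero => intro a; exact prod_pos fun _ _ => S.base_pos _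
  | succ k ih =>
    intro a
    unfold count
    split
    · exact Nat.add_pos_left (ih _) _
    · exact ih _

theorem count_le {B : ℕ} (hB : ∀ i, S.base i ≤ B) (r k : ℕ) :
    ∀ a, S.count r k a ≤ 2 ^ k * B ^ S.K := by
  have hBpos : 0 < B := (S.base_pos 0).trans_le (hB 0)
  induction k with
  | zero =>
    intro a
    simp only [count, pow_zero, one_mul]
    refine (prod_le_pow_card _ _ B fun _ _ => hB _).trans (Nat.pow_le_pow_right hBpos ?_)
    simpa using card_filter_le (range S.K) _
  | succ k ih =>
    intro a
    unfold count
    rw [pow_succ]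
    split
    · have h₁ := ih (Function.update a k false)
      have h₂ := ih (Function.update a k true)
      linarith
    · have := ih a
      linarith

/-- The assignment `S.fval i` falsifies the clause `i`, so passing from `S.rank i` to `S.rank i + 1`
adds exactly the factor `S.weight k i` in `count_eq`. Every weight is thereby a quotient of two
natural numbers of controlled size. -/
theorem count_rank_succ {i : ℕ} (hi : i < S.K) (k : ℕ) :
    (S.count (S.rank i + 1) k (S.fval i) : ℚ) = S.weight k i * S.count (S.rank i) k (S.fval i) := by
  have : {j ∈ range S.K | S.rank j < S.rank i + 1 ∧ S.Falsified k j (S.fval i)} =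
      insert i {j ∈ range S.K | S.rank j < S.rank i ∧ S.Falsified k j (S.fval i)} := by
    ext j
    simp only [mem_filter, mem_range, mem_insert]
    constructor
    · rintro ⟨h₁, h₂, h₃⟩
      by_cases h : S.rank j = S.rank i
      · exact .inl (S.rank_inj j h₁ i hi h)
      · exact .inr ⟨h₁, by omega, h₃⟩
    · rintro (rfl | ⟨h₁, h₂, h₃⟩)
      · exact ⟨hi, by omega, fun _ _ _ => rfl⟩
      · exact ⟨h₁, by omega, h₃⟩
  rw [count_eq, count_eq, this, prod_insert (by simp)]
  ring

/-- Numerators and denominators of the weights are bounded by numbers of extensions. -/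
theorem le_of_weight_eq {B : ℕ} (hB : ∀ i, S.base i ≤ B) {i k p q : ℕ} (hi : i < S.K)
    (hpq : p.Coprime q) (hq : 0 < q) (h : S.weight k i = (p : ℚ) / q) :
    p ≤ 2 ^ k * B ^ S.K ∧ q ≤ 2 ^ k * B ^ S.K := by
  have h₁ := count_rank_succ hi k
  have hq' : (q : ℚ) ≠ 0 := by exact_mod_cast hq.ne'
  rw [h, div_mul_eq_mul_div, eq_div_iff hq'] at h₁
  have h₂ : S.count (S.rank i + 1) k (S.fval i) * q = p * S.count (S.rank i) k (S.fval i) := by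
    exact_mod_cast h₁
  constructor
  · refine le_trans (Nat.le_of_dvd (count_pos _ _ _) ?_) (count_le hB (S.rank i + 1) k (S.fval i))
    exact hpq.dvd_of_dvd_mul_right (Dvd.intro _ h₂.symm)
  · refine le_trans (Nat.le_of_dvd (count_pos _ _ _) ?_) (count_le hB (S.rank i) k (S.fval i))
    exact hpq.symm.dvd_of_dvd_mul_left (Dvd.intro_left _ h₂)

theorem count_eq_sum_powerset (r k : ℕ) : ∀ a : ℕ → Bool, S.count r k a =
    ∑ s ∈ {l ∈ range k | S.Used l}.powerset,
      S.count r 0 fun l => if l < k ∧ S.Used l then decide (l ∈ s) else a l := by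
  induction k with
  | zero => intro a; simp
  | succ k ih =>
    intro a
    rw [count]
    split
    · next hk =>
      have hni : k ∉ {l ∈ range k | S.Used l} := by simp
      rw [ih, ih, range_add_one, filter_insert, if_pos hk, sum_powerset_insert hni]
      congr 1 <;> refine sum_congr rfl fun s hs => ?_ <;> congr 1 <;> funext l <;>
        have hks : k ∉ s := fun h => hni (mem_powerset.1 hs h)
      · by_cases hl : l = k
        · subst hl; simp [hk, hks]
        · simp [hl, show l < k + 1 ↔ l < k by omega]
      · by_cases hl : l = k
        · subst hl; simp [hk]
        · simp [hl, show l < k + 1 ↔ l < k by omega]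
    · next hk =>
      rw [ih, range_add_one, filter_insert, if_neg hk]
      refine sum_congr rfl fun s hs => ?_
      congr 1; funext l
      by_cases hl : l = k
      · subst hl; simp [hk]
      · simp [show l < k + 1 ↔ l < k by omega]

/-- The product of the final weights counts the assignments, each one weighted by the clauses that
it falsifies. -/
theorem two_pow_mul_prod_weight {n : ℕ} (hn : ∀ i < S.K, ∀ l, S.has i l → l < n) :
    (2 : ℚ) ^ #{l ∈ range n | S.Used l} * ∏ j ∈ range S.K, S.weight n j =
      ((∑ s ∈ {l ∈ range n | S.Used l}.powerset,
        ∏ j ∈ range S.K with S.Falsified 0 j fun l => decide (l ∈ s), S.base j : ℕ) : ℚ) := by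
  have hr : ∀ j ∈ range S.K, S.rank j < ∑ i ∈ range S.K, S.rank i + 1 := fun j hj =>
    Nat.lt_succ_of_le (single_le_sum_of_canonicallyOrdered (f := S.rank) hj)
  -- The rank bound exceeds every rank, and no variable is left from `n` on, so every clause is
  -- vacuously falsified and the product runs over all of them.
  have h₁ := count_eq (S := S) (∑ i ∈ range S.K, S.rank i + 1) n fun _ => false
  have hall : {j ∈ range S.K | S.rank j < ∑ i ∈ range S.K, S.rank i + 1 ∧
      S.Falsified n j fun _ => false} = range S.K := filter_true_of_mem fun j hj =>
    ⟨hr j hj, fun l hl hjl => absurd (hn j (mem_range.1 hj) l hjl) (by omega)⟩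
  rw [hall] at h₁
  rw [← h₁, count_eq_sum_powerset]
  congr 1
  refine sum_congr rfl fun s hs => ?_
  rw [count]
  refine prod_congr (filter_congr fun j hj => ?_) fun _ _ => rfl
  rw [and_iff_right (hr j hj)]
  refine iff_of_eq (congrArg _ (funext fun l => ?_))
  split
  · rfl
  · next hl =>
    have : l ∉ s := fun h => hl (by simpa using mem_powerset.1 hs h)
    simp [this]

end ClauseSystem

/-! ### Iterated division with remainder -/

/-- One step of the Euclidean algorithm. -/
def euclidStep (x : ℕ × ℕ) : ℕ × ℕ := (x.2, x.1 % x.2)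

theorem gcd_euclidStep (x : ℕ × ℕ) : (euclidStep x).1.gcd (euclidStep x).2 = x.1.gcd x.2 := by
  simp only [euclidStep]
  rw [Nat.gcd_comm, ← Nat.gcd_rec, Nat.gcd_comm]

/-- Since `x % 0 = x`, the iteration does not stop at `(g, 0)` but alternates between `(g, 0)` and
`(0, g)`; the sum is `g` in both cases. -/
theorem euclidStep_iterate_of_mul_eq_zero (n : ℕ) : ∀ x : ℕ × ℕ, x.1 * x.2 = 0 →
    (euclidStep^[n] x).1 + (euclidStep^[n] x).2 = x.1.gcd x.2 := by
  induction n with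
  | zero =>
    rintro ⟨a, b⟩ h
    rcases Nat.mul_eq_zero.1 h with h | h <;> simp_all
  | succ n ih =>
    intro x h
    rw [Function.iterate_succ_apply, ih, gcd_euclidStep]
    obtain ⟨a, b⟩ := x
    rcases Nat.mul_eq_zero.1 h with h | h <;> simp_all [euclidStep]

/-- For `0 < b < a` the remainder `a % b` is at most `a / 2`, so a step at least halves the product
of the pair. -/
theorem euclidStep_iterate_of_lt (n : ℕ) : ∀ x : ℕ × ℕ, x.2 < x.1 → x.1 * x.2 < 2 ^ n →
    (euclidStep^[n] x).1 + (euclidStep^[n] x).2 = x.1.gcd x.2 := by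
  induction n with
  | zero => intro x _ h; exact euclidStep_iterate_of_mul_eq_zero 0 x (by omega)
  | succ n ih =>
    rintro ⟨a, b⟩ h h'
    rcases Nat.eq_zero_or_pos b with rfl | hb
    · exact euclidStep_iterate_of_mul_eq_zero _ _ (by simp)
    rw [Function.iterate_succ_apply, ih, gcd_euclidStep]
    · exact Nat.mod_lt _ hb
    · simp only [euclidStep]
      have h₁ := Nat.mod_add_div a b
      have h₂ : 1 ≤ a / b := Nat.div_pos h.le hb
      have h₃ := Nat.mod_lt a hb
      have : 2 * (a % b) ≤ a := by nlinarith
      rw [pow_succ] at h'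
      simp only at h'
      nlinarith

/-- Sufficiently many steps of the Euclidean algorithm lead to a pair whose sum is the greatest
common divisor, whatever the parity of their number. -/
theorem euclidStep_iterate_add {n m : ℕ} (hmn : m < n) {x : ℕ × ℕ} (h : x.1 * x.2 < 2 ^ m) :
    (euclidStep^[n] x).1 + (euclidStep^[n] x).2 = x.1.gcd x.2 := by
  -- One step is spent on bringing the pair into decreasing order; it does not increase the product.
  obtain ⟨n, rfl⟩ : ∃ n', n = n' + 1 := ⟨n - 1, by omega⟩
  rw [Function.iterate_succ_apply, ← gcd_euclidStep]
  obtain ⟨a, b⟩ := x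
  rcases Nat.eq_zero_or_pos b with rfl | hb
  · exact euclidStep_iterate_of_mul_eq_zero _ _ (by simp [euclidStep])
  · refine euclidStep_iterate_of_lt _ _ (Nat.mod_lt _ hb) ?_
    simp only [euclidStep]
    calc b * (a % b) ≤ a * b := by
          rw [mul_comm]; exact Nat.mul_le_mul_right _ (Nat.mod_le _ _)
      _ < 2 ^ m := h
      _ ≤ 2 ^ n := Nat.pow_le_pow_right (by norm_num) (by omega)

/-! ### The positions of an encoded formula -/

namespace SAT

/-- In the word `w`, the position `p` belongs to the clause whose end marker is at `i`. -/
def InClause (w : List ℕ) (p i : ℕ) : Prop :=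
  p < i ∧ i < w.length ∧ w.getD i 0 = 0 ∧ ∀ z, p ≤ z → z < i → w.getD z 0 ≠ 0

/-- The variable at the position `p` of the word `w`. -/
def varAt (w : List ℕ) (p : ℕ) : ℕ := (w.getD p 0 - 1) / 2

/-- The word `w` has at `i` the end marker of a clause with the literals of `C`. -/
def HasClauseAt (w : List ℕ) (i : ℕ) (C : Clause) : Prop :=
  i < w.length ∧ w.getD i 0 = 0 ∧
    ∀ c, (∃ p, InClause w p i ∧ w.getD p 0 = c) ↔ ∃ l ∈ C, l.encode = c

theorem Literal.encode_ne_zero (l : Literal) : l.encode ≠ 0 := by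
  unfold Literal.encode; split <;> omega

theorem Literal.encode_sub_one_div_two (l : Literal) : (l.encode - 1) / 2 = l.var := by
  unfold Literal.encode; split <;> omega

theorem Literal.encode_mod_two (l : Literal) : l.encode % 2 = 1 ↔ l.sign = true := by
  unfold Literal.encode; split <;> simp_all

theorem CNF.encode_cons (C : Clause) (F : CNF) :
    CNF.encode (C :: F) = C.map Literal.encode ++ 0 :: CNF.encode F := by
  simp [CNF.encode]

theorem getD_map_encode {C : Clause} {w : List ℕ} {p : ℕ} (hp : p < C.length) :
    (C.map Literal.encode ++ 0 :: w).getD p 0 = C[p].encode := by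
  rw [List.getD_append _ _ _ _ (by simpa using hp), List.getD_eq_getElem _ _ (by simpa using hp),
    List.getElem_map]

theorem getD_length {C : Clause} {w : List ℕ} :
    (C.map Literal.encode ++ 0 :: w).getD C.length 0 = 0 := by
  rw [List.getD_append_right _ _ _ _ (by simp)]; simp

theorem getD_length_add {C : Clause} {w : List ℕ} (p : ℕ) :
    (C.map Literal.encode ++ 0 :: w).getD (C.length + 1 + p) 0 = w.getD p 0 := by
  rw [List.getD_append_right _ _ _ _ (by simp; omega)]
  simp [show C.length + 1 + p - C.length = p + 1 by omega]

theorem hasClauseAt_length (C : Clause) (w : List ℕ) :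
    HasClauseAt (C.map Literal.encode ++ 0 :: w) C.length C := by
  refine ⟨by simp, getD_length, fun c => ⟨?_, ?_⟩⟩
  · rintro ⟨p, ⟨hp, -⟩, rfl⟩
    exact ⟨C[p], List.getElem_mem hp, (getD_map_encode hp).symm⟩
  · rintro ⟨l, hl, rfl⟩
    obtain ⟨p, hp, rfl⟩ := List.getElem_of_mem hl
    refine ⟨p, ⟨hp, by simp, getD_length, fun z _ hz => ?_⟩, getD_map_encode hp⟩
    rw [getD_map_encode hz]
    exact Literal.encode_ne_zero _

theorem HasClauseAt.shift {w : List ℕ} {i : ℕ} {D : Clause} (h : HasClauseAt w i D) (C : Clause) :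
    HasClauseAt (C.map Literal.encode ++ 0 :: w) (C.length + 1 + i) D := by
  obtain ⟨h₁, h₂, h₃⟩ := h
  have hlen : C.length + 1 + i < (C.map Literal.encode ++ 0 :: w).length := by simp; omega
  refine ⟨hlen, by rw [getD_length_add, h₂], fun c => ?_⟩
  rw [← h₃ c]
  constructor
  · rintro ⟨p, ⟨hp, -, -, hz⟩, rfl⟩
    -- Otherwise the end marker of `C` would lie between `p` and the marker of the clause that `p`
    -- belongs to.
    have hpC : C.length < p := by
      by_contra hle
      exact hz C.length (by omega) (by omega) getD_length
    obtain ⟨p', rfl⟩ : ∃ p', p = C.length + 1 + p' := ⟨p - (C.length + 1), by omega⟩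
    refine ⟨p', ⟨by omega, h₁, h₂, fun z hz₁ hz₂ => ?_⟩, (getD_length_add _).symm⟩
    rw [← getD_length_add (C := C)]
    exact hz _ (by omega) (by omega)
  · rintro ⟨p, ⟨hp, -, -, hz⟩, rfl⟩
    refine ⟨C.length + 1 + p, ⟨by omega, hlen, by rw [getD_length_add, h₂], fun z hz₁ hz₂ => ?_⟩,
      getD_length_add _⟩
    obtain ⟨z', rfl⟩ : ∃ z', z = C.length + 1 + z' := ⟨z - (C.length + 1), by omega⟩
    rw [getD_length_add]
    exact hz _ (by omega) (by omega)

theorem CNF.exists_hasClauseAt {F : CNF} {C : Clause} (hC : C ∈ F) :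
    ∃ i, HasClauseAt F.encode i C := by
  induction F with
  | nil => simp at hC
  | cons D F ih =>
    rw [CNF.encode_cons]
    rcases List.mem_cons.1 hC with rfl | hC
    · exact ⟨_, hasClauseAt_length _ _⟩
    · obtain ⟨i, hi⟩ := ih hC
      exact ⟨_, hi.shift D⟩

theorem CNF.exists_clause {F : CNF} {i : ℕ} (hi : i < F.encode.length)
    (h : F.encode.getD i 0 = 0) : ∃ C ∈ F, HasClauseAt F.encode i C := by
  induction F generalizing i with
  | nil => simp [CNF.encode] at hi
  | cons D F ih =>
    rw [CNF.encode_cons] at hi h ⊢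
    rcases lt_trichotomy i D.length with hlt | rfl | hlt
    · rw [getD_map_encode hlt] at h
      exact absurd h (Literal.encode_ne_zero _)
    · exact ⟨D, by simp, hasClauseAt_length _ _⟩
    · obtain ⟨j, rfl⟩ : ∃ j, i = D.length + 1 + j := ⟨i - (D.length + 1), by omega⟩
      rw [getD_length_add] at h
      obtain ⟨C, hC, hC'⟩ := ih (i := j) (by simp at hi; omega) h
      exact ⟨C, List.mem_cons_of_mem _ hC, hC'.shift D⟩

/-- The clause with the end marker at `i` contains the variable `v`. -/
def HasVar (w : List ℕ) (i v : ℕ) : Prop := ∃ p, InClause w p i ∧ varAt w p = v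

theorem HasClauseAt.hasVar_iff {w : List ℕ} {i : ℕ} {C : Clause} (h : HasClauseAt w i C) {v : ℕ} :
    HasVar w i v ↔ v ∈ Clause.vars C := by
  simp only [Clause.vars, List.mem_toFinset, List.mem_map, HasVar, varAt]
  constructor
  · rintro ⟨p, hp, rfl⟩
    obtain ⟨l, hl, hl'⟩ := (h.2.2 _).1 ⟨p, hp, rfl⟩
    exact ⟨l, hl, by rw [← hl', Literal.encode_sub_one_div_two]⟩
  · rintro ⟨l, hl, rfl⟩
    obtain ⟨p, hp, hp'⟩ := (h.2.2 _).2 ⟨l, hl, rfl⟩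
    exact ⟨p, hp, by rw [hp', Literal.encode_sub_one_div_two]⟩

theorem CNF.mem_vars_iff {F : CNF} {v : ℕ} : v ∈ F.vars ↔ ∃ i, HasVar F.encode i v := by
  constructor
  · intro h
    simp only [CNF.vars, List.mem_toFinset, List.mem_map, List.mem_flatten] at h
    obtain ⟨l, ⟨C, hC, hl⟩, rfl⟩ := h
    obtain ⟨i, hi⟩ := CNF.exists_hasClauseAt hC
    refine ⟨i, hi.hasVar_iff.2 ?_⟩
    simp only [Clause.vars, List.mem_toFinset, List.mem_map]
    exact ⟨l, hl, rfl⟩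
  · rintro ⟨i, p, hp, rfl⟩
    obtain ⟨C, hC, hi⟩ := CNF.exists_clause hp.2.1 hp.2.2.1
    exact Clause.vars_subset hC (hi.hasVar_iff.1 ⟨p, hp, rfl⟩)

/-- Every literal occupies a position of the word. Hence `len` rounds suffice for the elimination,
and the number of assignments is below `2 ^ len`. -/
theorem CNF.card_vars_le (F : CNF) : F.vars.card ≤ F.encode.length := by
  refine (List.toFinset_card_le _).trans ?_
  rw [List.length_map, CNF.encode, List.length_flatMap, List.length_flatten]
  exact List.sum_le_sum fun C _ => by simp

end SAT

/-! ### Nest points of induced subhypergraphs -/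

/-- The first vertex of the order that lies in `A` is a nest point of the subhypergraph induced by
`A`, because restricting to fewer vertices preserves chains. Eliminating an arbitrary available nest
point can therefore never lead to a dead end. -/
theorem Hypergraph.IsBetaEliminationOrder.exists_nest {α : Type*} {xs : List α} :
    ∀ {H : Hypergraph α}, H.IsBetaEliminationOrder xs → ∀ A : Set α, A ⊆ H.vertexSet → A.Nonempty →
      ∃ v ∈ A, ∀ e ∈ H.edgeSet, ∀ f ∈ H.edgeSet, v ∈ e → v ∈ f → e ∩ A ⊆ f ∨ f ∩ A ⊆ e := by
  induction xs with
  | nil =>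
    intro H h A hA ⟨v, hv⟩
    have : H.vertexSet = ∅ := h
    exact absurd (hA hv) (by simp [this])
  | cons x xs ih =>
    intro H h A hA hne
    obtain ⟨⟨-, hx⟩, h⟩ := h
    by_cases hxA : x ∈ A
    · refine ⟨x, hxA, fun e he f hf hxe hxf => ?_⟩
      rcases hx.total ⟨he, hxe⟩ ⟨hf, hxf⟩ with h' | h'
      · exact .inl (Set.inter_subset_left.trans h')
      · exact .inr (Set.inter_subset_left.trans h')
    · have hA' : A ⊆ H.vertexSet \ {x} := fun v hv => ⟨hA hv, fun hvx => hxA (hvx ▸ hv)⟩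
      obtain ⟨v, hv, hn⟩ := ih h A (fun v hv => ⟨hA hv, hA' hv⟩) hne
      refine ⟨v, hv, fun e he f hf hve hvf => ?_⟩
      have hmem : ∀ g ∈ H.edgeSet, v ∈ g →
          g ∩ (H.vertexSet \ {x}) ∈ (H.deleteVertex x).edgeSet :=
        fun g hg hvg => ⟨⟨v, hvg, hA' hv⟩, g, hg, rfl⟩
      rcases hn _ (hmem e he hve) _ (hmem f hf hvf) ⟨hve, hA' hv⟩ ⟨hvf, hA' hv⟩ with h' | h'
      · exact .inl fun u hu => (h' ⟨⟨hu.1, hA' hu.2⟩, hu.2⟩).1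
      · exact .inr fun u hu => (h' ⟨⟨hu.1, hA' hu.2⟩, hu.2⟩).1

namespace RAM

/-! ### Logical expressions -/

namespace Ex

instance : Add Ex := ⟨.bin .add⟩
instance : Sub Ex := ⟨.bin .sub⟩
instance : Mul Ex := ⟨.bin .mul⟩
instance : Div Ex := ⟨.bin .div⟩
instance (n : ℕ) : OfNat Ex n := ⟨.const n⟩

/-- An expression counts as true if its value is not `0`. -/
def Holds (w : List ℕ) (s : ArrState) (e : Ex) (ρ : ℕ → ℕ) : Prop := e.eval w s ρ ≠ 0

/-- Negation. -/
def neg (e : Ex) : Ex := 1 - e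

/-- Implication. -/
def imp (e f : Ex) : Ex := e.neg + f

/-- Equivalence. -/
def iff (e f : Ex) : Ex := e * f + e.neg * f.neg

/-- Less than. -/
def lt (e f : Ex) : Ex := f - e

/-- Equality. -/
def eq (e f : Ex) : Ex := (e.lt f + f.lt e).neg

/-- The universal quantifier, over the numbers below `len`. -/
def all (e : Ex) : Ex := .agg true e

/-- The existential quantifier, over the numbers below `len`. -/
def ex (e : Ex) : Ex := .agg false e

/-- Case distinction. -/
def ite (c e f : Ex) : Ex := c.neg.neg * e + c.neg * f

variable {w : List ℕ} {s : ArrState} {ρ : ℕ → ℕ}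

@[simp] theorem eval_add (e f : Ex) : (e + f).eval w s ρ = e.eval w s ρ + f.eval w s ρ := rfl
@[simp] theorem eval_sub (e f : Ex) : (e - f).eval w s ρ = e.eval w s ρ - f.eval w s ρ := rfl
@[simp] theorem eval_mul (e f : Ex) : (e * f).eval w s ρ = e.eval w s ρ * f.eval w s ρ := rfl
@[simp] theorem eval_div (e f : Ex) : (e / f).eval w s ρ = e.eval w s ρ / f.eval w s ρ := rfl
@[simp] theorem eval_two : (2 : Ex).eval w s ρ = 2 := rfl
@[simp] theorem eval_zero : (0 : Ex).eval w s ρ = 0 := rfl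
@[simp] theorem eval_one : (1 : Ex).eval w s ρ = 1 := rfl
@[simp] theorem eval_var (n : ℕ) : (var n).eval w s ρ = ρ n := rfl
@[simp] theorem eval_len : len.eval w s ρ = w.length + 2 := rfl
@[simp] theorem eval_inp (n : ℕ) : (inp n).eval w s ρ = w.getD (ρ n) 0 := rfl
@[simp] theorem eval_arr (a : Fin 14) (e : Ex) : (arr a e).eval w s ρ = s a (e.eval w s ρ) := rfl
theorem eval_agg_true (e : Ex) : (agg true e).eval w s ρ =
    ∏ i ∈ Finset.range (w.length + 2), e.eval w s (push i ρ) := rfl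
theorem eval_agg_false (e : Ex) : (agg false e).eval w s ρ =
    ∑ i ∈ Finset.range (w.length + 2), e.eval w s (push i ρ) := rfl

@[simp] theorem holds_neg (e : Ex) : e.neg.Holds w s ρ ↔ ¬ e.Holds w s ρ := by
  simp only [Holds, neg, eval_sub, eval_one]; omega

@[simp] theorem holds_mul (e f : Ex) :
    (e * f).Holds w s ρ ↔ e.Holds w s ρ ∧ f.Holds w s ρ := by
  simp [Holds]

@[simp] theorem holds_add (e f : Ex) :
    (e + f).Holds w s ρ ↔ e.Holds w s ρ ∨ f.Holds w s ρ := by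
  simp only [Holds, eval_add]; omega

@[simp] theorem holds_imp (e f : Ex) :
    (e.imp f).Holds w s ρ ↔ (e.Holds w s ρ → f.Holds w s ρ) := by
  simp [imp, imp_iff_not_or]

@[simp] theorem holds_iff (e f : Ex) :
    (e.iff f).Holds w s ρ ↔ (e.Holds w s ρ ↔ f.Holds w s ρ) := by
  simp only [iff, holds_add, holds_mul, holds_neg]; tauto

@[simp] theorem holds_lt (e f : Ex) :
    (e.lt f).Holds w s ρ ↔ e.eval w s ρ < f.eval w s ρ := by
  simp only [Holds, lt, eval_sub]; omega

@[simp] theorem holds_eq (e f : Ex) :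
    (e.eq f).Holds w s ρ ↔ e.eval w s ρ = f.eval w s ρ := by
  simp only [eq, holds_neg, holds_add, holds_lt]; omega

@[simp] theorem holds_all (e : Ex) :
    e.all.Holds w s ρ ↔ ∀ i < w.length + 2, e.Holds w s (push i ρ) := by
  simp [Holds, all, eval_agg_true, Finset.prod_eq_zero_iff]

@[simp] theorem holds_ex (e : Ex) :
    e.ex.Holds w s ρ ↔ ∃ i < w.length + 2, e.Holds w s (push i ρ) := by
  simp [Holds, ex, eval_agg_false]

open scoped Classical in
@[simp] theorem eval_ite (c e f : Ex) : (c.ite e f).eval w s ρ =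
    if c.Holds w s ρ then e.eval w s ρ else f.eval w s ρ := by
  have h : ∀ x : ℕ, (1 - (1 - x)) = if x ≠ 0 then 1 else 0 := by intro x; split <;> omega
  have h' : ∀ x : ℕ, 1 - x = if x ≠ 0 then 0 else 1 := by intro x; split <;> omega
  simp only [ite, neg, eval_add, eval_mul, eval_sub, eval_one, Holds]
  rw [h, h']
  split <;> simp_all

end Ex

open Ex SAT

variable {w : List ℕ} {s : ArrState} {ρ : ℕ → ℕ}

theorem _root_.SAT.InClause.lt {p i : ℕ} (h : InClause w p i) :
    p < w.length + 2 ∧ i < w.length + 2 :=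
  ⟨by have := h.1; have := h.2.1; omega, by have := h.2.1; omega⟩

/-- The position `p` belongs to the clause `i`. -/
def inClauseE (p i : ℕ) : Ex :=
  (var p).lt (var i) * (var i).lt (len - 2) * (inp i).eq 0 *
    ((((var 0).lt (var (p + 1))).neg * (var 0).lt (var (i + 1))).imp ((inp 0).eq 0).neg).all

@[simp] theorem holds_inClauseE (p i : ℕ) :
    (inClauseE p i).Holds w s ρ ↔ InClause w (ρ p) (ρ i) := by
  simp only [inClauseE, holds_mul, holds_lt, holds_eq, holds_all, holds_imp, holds_neg, eval_var,
    eval_sub, eval_len, eval_inp, eval_zero, eval_two, push_zero, push_succ, InClause]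
  constructor
  · rintro ⟨⟨⟨h₁, h₂⟩, h₃⟩, h₄⟩
    exact ⟨h₁, by omega, h₃, fun z hz hz' => h₄ z (by omega) ⟨by omega, hz'⟩⟩
  · rintro ⟨h₁, h₂, h₃, h₄⟩
    exact ⟨⟨⟨h₁, by omega⟩, h₃⟩, fun z _ hz => h₄ z (by omega) hz.2⟩

/-- The variable at the position `p`. -/
def varAtE (p : ℕ) : Ex := (inp p - 1) / 2

@[simp] theorem eval_varAtE (p : ℕ) : (varAtE p).eval w s ρ = varAt w (ρ p) := rfl

/-- The clause `i` contains the variable at the position `p`. -/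
def hasVarE (i p : ℕ) : Ex := (inClauseE 0 (i + 1) * (varAtE 0).eq (varAtE (p + 1))).ex

@[simp] theorem holds_hasVarE (i p : ℕ) :
    (hasVarE i p).Holds w s ρ ↔ HasVar w (ρ i) (varAt w (ρ p)) := by
  simp only [hasVarE, holds_ex, holds_mul, holds_inClauseE, holds_eq, eval_varAtE, push_zero,
    push_succ, HasVar]
  exact ⟨fun ⟨q, _, h⟩ => ⟨q, h⟩, fun ⟨q, h⟩ => ⟨q, h.1.lt.1, h⟩⟩

/-! ### Finding an elimination order -/

/-- The variables not yet eliminated of the clause `i` belong to the clause `j`. -/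
def subE (i j : ℕ) : Ex :=
  ((inClauseE 0 (i + 1) * (arr 1 (var 0)).eq 0).imp (hasVarE (j + 1) 0)).all

/-- The variable at the position `p` is a nest point among the variables not yet eliminated. -/
def nestE (p : ℕ) : Ex :=
  (inClauseE (p + 1) 0).ex * (arr 1 (var p)).eq 0 *
    ((hasVarE 1 (p + 2) * hasVarE 0 (p + 2)).imp (subE 1 0 + subE 0 1)).all.all

/-- Find a position of a nest point. -/
def selectE : Ex := nestE 0 * (((var 0).lt (var 1)).imp (nestE 0).neg).all

/-- Eliminate one nest point and count the rounds. -/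
def orderStep : Stmt :=
  .seq (.assign 2 selectE) (.seq
    (.assign 1 ((arr 2 (var 0) * (varAtE 0).eq (varAtE 1)).ex.ite (arr 3 0 + 1) (arr 1 (var 0))))
    (.assign 3 (arr 3 0 + 1)))

/-- Compute an elimination order: the variable at the position `p` is eliminated at the time
`arr 1 p`. -/
def orderStmt : Stmt := .rep orderStep

/-- The clauses that contain the variable `v` form a chain when only the variables in `R` are
considered. -/
def Nested (w : List ℕ) (R : ℕ → Prop) (v : ℕ) : Prop :=
  ∀ i j, HasVar w i v → HasVar w j v →
    (∀ u, R u → HasVar w i u → HasVar w j u) ∨ (∀ u, R u → HasVar w j u → HasVar w i u)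

/-- The function `τ` gives the elimination times of the variables that were eliminated in the first
`n` rounds, and `0` for the other ones. -/
structure IsPartialElimination (w : List ℕ) (V : Finset ℕ) (n : ℕ) (τ : ℕ → ℕ) : Prop where
  le : ∀ v, τ v ≤ n
  le_card : ∀ v, τ v ≤ V.card
  inj : ∀ u v, τ u = τ v → τ u ≠ 0 → u = v
  nested : ∀ v, τ v ≠ 0 → Nested w (fun u => τ u = 0 ∨ τ v < τ u) v
  card : (V.filter fun v => τ v = 0).card + n ≤ V.card ∨ ∀ v ∈ V, τ v ≠ 0

/-- For `v`, the variables that come later are among those still uneliminated, as no time exceeds `n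
+ 1`. For a variable eliminated before, `v` already counted as later while its time was `0`, so its
nest condition still applies. -/
theorem IsPartialElimination.update {V : Finset ℕ} {n : ℕ} {τ : ℕ → ℕ} (h : IsPartialElimination w V n τ)
    {v : ℕ} (hv : v ∈ V) (h0 : τ v = 0) (hn : Nested w (fun u => τ u = 0) v) :
    IsPartialElimination w V (n + 1) (Function.update τ v (n + 1)) := by
  have hmem : v ∈ V.filter fun v => τ v = 0 := Finset.mem_filter.2 ⟨hv, h0⟩
  have hcard : (V.filter fun v => τ v = 0).card + n ≤ V.card :=
    h.card.resolve_right fun h' => h' v hv h0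
  have hpos := Finset.card_pos.2 ⟨v, hmem⟩
  have hle := h.le
  refine ⟨fun u => ?_, fun u => ?_, fun u u' => ?_, fun u => ?_, .inl ?_⟩
  · have := hle u
    by_cases hu : u = v <;> simp [hu]
    omega
  · have := h.le_card u
    by_cases hu : u = v
    · simp [hu]; omega
    · simpa [hu] using this
  · have h₁ := hle u
    have h₂ := hle u'
    by_cases hu : u = v <;> by_cases hu' : u' = v <;> simp [hu, hu']
    · omega
    · omega
    · exact h.inj u u'
  · by_cases hu : u = v
    · subst hu
      intro _ i j hi hj
      refine (hn i j hi hj).imp ?_ ?_ <;> intro h' x hx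
      all_goals
        refine h' x ?_
        have := hle x
        by_cases hxu : x = u <;> simp [hxu] at hx ⊢
        omega
    · intro hu0 i j hi hj
      simp only [Function.update_of_ne hu] at hu0
      refine (h.nested u hu0 i j hi hj).imp ?_ ?_ <;> intro h' x hx
      all_goals
        refine h' x ?_
        by_cases hxv : x = v
        · subst hxv; exact .inl h0
        · simpa [hu, hxv] using hx
  · have : (V.filter fun u => Function.update τ v (n + 1) u = 0) ⊆
        (V.filter fun u => τ u = 0).erase v := by
      intro u hu
      simp only [Finset.mem_filter, Finset.mem_erase] at hu ⊢
      by_cases huv : u = v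
      · simp [huv] at hu
      · simpa [huv] using hu
    have := Finset.card_le_card this
    rw [Finset.card_erase_of_mem hmem] at this
    omega

theorem IsPartialElimination.succ {V : Finset ℕ} {n : ℕ} {τ : ℕ → ℕ} (h : IsPartialElimination w V n τ)
    (h0 : ∀ v ∈ V, τ v ≠ 0) : IsPartialElimination w V (n + 1) τ :=
  ⟨fun v => (h.le v).trans (Nat.le_succ n), h.le_card, h.inj, h.nested, .inr h0⟩

/-- The array `1` holds the elimination times `τ`. -/
def HoldsTimes (w : List ℕ) (s : ArrState) (τ : ℕ → ℕ) : Prop :=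
  ∀ p < w.length + 2, s 1 p = τ (varAt w p)

theorem holds_subE {τ : ℕ → ℕ} (hτ : HoldsTimes w s τ) (i j : ℕ) :
    (subE i j).Holds w s ρ ↔ ∀ u, τ u = 0 → HasVar w (ρ i) u → HasVar w (ρ j) u := by
  simp only [subE, holds_all, holds_imp, holds_mul, holds_inClauseE, holds_eq, eval_arr, eval_var,
    holds_hasVarE, push_zero, push_succ, eval_zero]
  constructor
  · rintro h u hu ⟨p, hp, rfl⟩
    exact h p hp.lt.1 ⟨hp, by rwa [hτ p hp.lt.1]⟩
  · rintro h p hp ⟨h₁, h₂⟩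
    exact h _ (by rwa [← hτ p hp]) ⟨p, h₁, rfl⟩

theorem holds_nestE {τ : ℕ → ℕ} (hτ : HoldsTimes w s τ) (p : ℕ) (hp : ρ p < w.length + 2) :
    (nestE p).Holds w s ρ ↔ (∃ i, InClause w (ρ p) i) ∧ τ (varAt w (ρ p)) = 0 ∧
      Nested w (fun u => τ u = 0) (varAt w (ρ p)) := by
  simp only [nestE, holds_mul, holds_ex, holds_inClauseE, holds_eq, eval_arr, eval_var, eval_zero,
    holds_all, holds_imp, holds_hasVarE, holds_add, holds_subE hτ, push_zero, push_succ, hτ _ hp,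
    and_assoc, Nested]
  refine and_congr ⟨fun ⟨i, _, h⟩ => ⟨i, h⟩, fun ⟨i, h⟩ => ⟨i, h.lt.2, h⟩⟩
    (and_congr_right fun _ => ⟨fun h i j hi hj => ?_, fun h i _ j _ hij => h i j hij.1 hij.2⟩)
  obtain ⟨q, hq, -⟩ := id hi
  obtain ⟨q', hq', -⟩ := id hj
  exact h i hq.lt.2 j hq'.lt.2 ⟨hi, hj⟩

/-- Every nonempty set of variables has a nest point. -/
def HasNestPoints (w : List ℕ) (V : Finset ℕ) : Prop :=
  ∀ τ : ℕ → ℕ, (∃ v ∈ V, τ v = 0) → ∃ v ∈ V, τ v = 0 ∧ Nested w (fun u => τ u = 0) v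

/-- Truncation does not change the truth value of a logical expression stored in an array. -/
theorem min_ne_zero_iff {a b : ℕ} : min a (2 ^ b) ≠ 0 ↔ a ≠ 0 := by
  have : 0 < 2 ^ b := by positivity
  omega

/-- Elimination times and round numbers pass the truncation unchanged. -/
theorem len_lt_pow (w : List ℕ) : 2 * (w.length + 2) ≤ 2 ^ (w.length + 2) ^ 5 := by
  have h₁ : w.length + 2 < 2 ^ (w.length + 2) := Nat.lt_two_pow_self
  calc 2 * (w.length + 2) ≤ 2 ^ 1 * 2 ^ (w.length + 2) := by omega
    _ = 2 ^ (1 + (w.length + 2)) := (pow_add _ _ _).symm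
    _ ≤ _ := Nat.pow_le_pow_right (by norm_num) (by
      have : (w.length + 2) ^ 2 ≤ (w.length + 2) ^ 5 := Nat.pow_le_pow_right (by omega) (by omega)
      nlinarith)

/-- Names of variables may be far larger than `len`, so a variable is handled through the positions
where it occurs. The first position carrying a nest point selects the variable, and all positions
with the same variable get the new time. When no variable is left, nothing is selected and only the
round number changes. -/
theorem exists_exec_orderStep {V : Finset ℕ} (hV : ∀ v, v ∈ V ↔ ∃ i, HasVar w i v)
    (hnest : HasNestPoints w V) {n : ℕ} (hn : n < w.length + 2) {s : ArrState} {τ : ℕ → ℕ}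
    (hτ : HoldsTimes w s τ) (hs : s 3 0 = n) (h : IsPartialElimination w V n τ) :
    ∃ τ', HoldsTimes w (orderStep.exec w s) τ' ∧
      orderStep.exec w s 3 0 = n + 1 ∧ IsPartialElimination w V (n + 1) τ' := by
  classical
  have hK := len_lt_pow w
  set Nst : ℕ → Prop := fun p => (∃ i, InClause w p i) ∧ τ (varAt w p) = 0 ∧
      Nested w (fun u => τ u = 0) (varAt w p) with hNst
  have hsel : ∀ p < w.length + 2, min (selectE.eval w s fun _ => p) (2 ^ (w.length + 2) ^ 5) ≠ 0 ↔
      Nst p ∧ ∀ q < p, ¬ Nst q := by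
    intro p hp
    rw [min_ne_zero_iff]
    change selectE.Holds w s (fun _ => p) ↔ _
    rw [selectE, holds_mul, holds_nestE hτ 0 hp, holds_all]
    refine and_congr_right fun _ => ⟨fun h q hq => ?_, fun h q hq => ?_⟩
    · have := h q (by omega)
      rw [holds_imp, holds_neg, holds_nestE hτ 0 (by simp; omega)] at this
      exact this (by simpa using hq)
    · rw [holds_imp, holds_neg, holds_nestE hτ 0 (by simpa using hq)]
      intro hqp
      exact h q (by simpa using hqp)
  have hτn : ∀ v, τ v ≤ 2 ^ (w.length + 2) ^ 5 := fun v => (h.le v).trans (by omega)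
  have hex1 : ∀ p < w.length + 2, orderStep.exec w s 1 p =
      if ∃ q < w.length + 2, (Nst q ∧ ∀ q' < q, ¬ Nst q') ∧ varAt w q = varAt w p then n + 1
      else τ (varAt w p) := by
    intro p hp
    simp only [orderStep, Stmt.exec, hp, and_true, Fin.isValue, show (1 : Fin 14) ≠ 3 by decide, if_false,
      if_true, false_and, eval_ite, eval_add, eval_arr, eval_zero, eval_one, eval_var,
      show (3 : Fin 14) ≠ 2 by decide, show (1 : Fin 14) ≠ 2 by decide, hs, hτ p hp]
    rw [min_eq_left (by split; · omega
                        · exact hτn _)]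
    refine if_congr ?_ rfl rfl
    simp only [holds_ex, holds_mul, holds_eq, eval_varAtE, push_zero, push_succ]
    refine exists_congr fun q => and_congr_right fun hq => and_congr_left fun _ => ?_
    rw [← hsel q hq]
    simp [Holds, hq]
  have hex3 : orderStep.exec w s 3 0 = n + 1 := by
    simp only [orderStep, Stmt.exec, Fin.isValue, show (3 : Fin 14) ≠ 1 by decide, show (3 : Fin 14) ≠ 2 by
      decide, false_and, if_false, true_and, eval_add, eval_arr, eval_zero, eval_one, hs]
    rw [if_pos (by omega), min_eq_left (by omega)]
  by_cases hall : ∀ v ∈ V, τ v ≠ 0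
  · refine ⟨τ, fun p hp => ?_, hex3, h.succ hall⟩
    rw [hex1 p hp, if_neg]
    rintro ⟨q, -, ⟨⟨⟨i, hi⟩, h0, -⟩, -⟩, -⟩
    exact hall _ ((hV _).2 ⟨i, q, hi, rfl⟩) h0
  · push Not at hall
    obtain ⟨v, hvV, hv0, hv⟩ := hnest τ hall
    have hN : ∃ q, Nst q := by
      obtain ⟨i, p, hp, rfl⟩ := (hV v).1 hvV
      exact ⟨p, ⟨i, hp⟩, hv0, hv⟩
    have hq := Nat.find_spec hN
    set q := Nat.find hN with hqdef
    have hqK : q < w.length + 2 := by obtain ⟨⟨i, hi⟩, -⟩ := hq; exact hi.lt.1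
    refine ⟨Function.update τ (varAt w q) (n + 1), fun p hp => ?_, hex3, h.update ?_ hq.2.1 hq.2.2⟩
    · rw [hex1 p hp]
      by_cases hpq : varAt w p = varAt w q
      · rw [if_pos ⟨q, hqK, ⟨hq, fun q' hq' => Nat.find_min hN hq'⟩, hpq.symm⟩, hpq,
          Function.update_self]
      · rw [if_neg, Function.update_of_ne hpq]
        rintro ⟨q', -, ⟨h₁, h₂⟩, h₃⟩
        have : q' = q := by
          refine le_antisymm ?_ (Nat.find_min' hN h₁)
          by_contra hlt
          exact h₂ q (by omega) hq
        exact hpq (by rw [← h₃, this])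
    · obtain ⟨⟨i, hi⟩, -⟩ := hq
      exact (hV _).2 ⟨i, q, hi, rfl⟩

/-- The function `τ` enumerates the variables in `V`, beginning with `1`, in an elimination
order. -/
structure IsOrder (w : List ℕ) (V : Finset ℕ) (τ : ℕ → ℕ) : Prop where
  le_card : ∀ v, τ v ≤ V.card
  ne_zero : ∀ v ∈ V, τ v ≠ 0
  inj : ∀ u ∈ V, ∀ v ∈ V, τ u = τ v → u = v
  nested : ∀ v ∈ V, Nested w (fun u => τ v < τ u) v

theorem exists_exec_orderStmt {V : Finset ℕ} (hV : ∀ v, v ∈ V ↔ ∃ i, HasVar w i v)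
    (hnest : HasNestPoints w V) (hcard : V.card < w.length + 2) :
    ∃ τ, HoldsTimes w (orderStmt.exec w fun _ _ => 0) τ ∧ IsOrder w V τ := by
  have key : ∀ n ≤ w.length + 2, ∃ τ, HoldsTimes w ((orderStep.exec w)^[n] fun _ _ => 0) τ ∧
      (orderStep.exec w)^[n] (fun _ _ => 0) 3 0 = n ∧ IsPartialElimination w V n τ := by
    intro n
    induction n with
    | zero =>
      intro _
      exact ⟨fun _ => 0, fun _ _ => rfl, rfl, by simp, by simp, by simp, by simp, by simp⟩
    | succ n ih =>
      intro hn
      obtain ⟨τ, h₁, h₂, h₃⟩ := ih (by omega)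
      rw [Function.iterate_succ_apply']
      exact exists_exec_orderStep hV hnest (by omega) h₁ h₂ h₃
  obtain ⟨τ, h₁, -, h₂⟩ := key _ le_rfl
  -- More than `V.card` rounds have been executed, so the counting alternative is impossible.
  have hne : ∀ v ∈ V, τ v ≠ 0 := h₂.card.resolve_left (by omega)
  refine ⟨τ, h₁, h₂.le_card, hne, fun u hu v _ h => h₂.inj u v h (hne u hu), fun v hv i j hi hj => ?_⟩
  exact (h₂.nested v (hne v hv) i j hi hj).imp (fun h u hu => h u (.inr hu))
    (fun h u hu => h u (.inr hu))

end RAM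

namespace RAM

open Ex SAT Finset
open scoped Classical

/-! ### The clause system of an input word -/

/-- The clause `i` contains a variable that is eliminated at time `k`. -/
def HasLevel (w : List ℕ) (τ : ℕ → ℕ) (i k : ℕ) : Prop :=
  ∃ p, InClause w p i ∧ τ (varAt w p) = k

/-- The clause `i` contains a variable that is eliminated at time `k` positively. -/
def PosLevel (w : List ℕ) (τ : ℕ → ℕ) (i k : ℕ) : Prop :=
  ∃ p, InClause w p i ∧ τ (varAt w p) = k ∧ w.getD p 0 % 2 = 1

/-- There is a clause with end marker at `i`, and it is not a tautology. -/
def IsProper (w : List ℕ) (i : ℕ) : Prop :=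
  i < w.length ∧ w.getD i 0 = 0 ∧ ∀ p q, InClause w p i → InClause w q i →
    varAt w p = varAt w q → w.getD p 0 = w.getD q 0

theorem _root_.SAT.InClause.hasVar {w : List ℕ} {p i : ℕ} (h : InClause w p i) :
    HasVar w i (varAt w p) :=
  ⟨p, h, rfl⟩

/-- Comparison of binary numbers: an additional digit of `B` above `k` outweighs all digits of `A`
up to `k`. It makes a single rank compatible with inclusion in every round. -/
theorem sum_two_pow_lt {A B : Finset ℕ} {k : ℕ} (h : ∀ l ∈ A, k < l → l ∈ B)
    (h' : ∃ l ∈ B, k < l ∧ l ∉ A) : ∑ l ∈ A, 2 ^ l < ∑ l ∈ B, 2 ^ l := by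
  obtain ⟨m, hmB, hkm, hmA⟩ := h'
  have h₁ : ∑ l ∈ A with ¬ k < l, 2 ^ l < 2 ^ m := Nat.geomSum_lt le_rfl fun l hl => by
    have := (mem_filter.1 hl).2; omega
  have h₂ : ∑ l ∈ insert m {l ∈ A | k < l}, 2 ^ l ≤ ∑ l ∈ B, 2 ^ l := by
    refine sum_le_sum_of_subset fun l hl => ?_
    rcases mem_insert.1 hl with rfl | hl
    · exact hmB
    · exact h l (mem_filter.1 hl).1 (mem_filter.1 hl).2
  rw [sum_insert (by simp [hmA])] at h₂
  rw [← sum_filter_add_sum_filter_not A (fun l => k < l)]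
  omega

theorem IsOrder.hasLevel_lt {w : List ℕ} {V : Finset ℕ} {τ : ℕ → ℕ} (h : IsOrder w V τ)
    (hcard : V.card < w.length + 2) {i k : ℕ} (hk : HasLevel w τ i k) : k < w.length + 2 := by
  obtain ⟨p, -, rfl⟩ := hk
  exact (h.le_card _).trans_lt hcard

/-- The weighted clauses of an input word, with an elimination order of its variables. -/
noncomputable def clauseSystem (w : List ℕ) {V : Finset ℕ} (hV : ∀ v, v ∈ V ↔ ∃ i, HasVar w i v)
    (hcard : V.card < w.length + 2) {τ : ℕ → ℕ} (h : IsOrder w V τ) : ClauseSystem where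
  K := w.length + 2
  has := HasLevel w τ
  fval i k := !decide (PosLevel w τ i k)
  -- The levels of the clause are read as a binary number, and the index `i` breaks ties between
  -- equal level sets.
  rank i := (w.length + 2) * ∑ l ∈ range (w.length + 2) with HasLevel w τ i l, 2 ^ l + i
  -- Tautologies and indices that are not end markers get the neutral weight `1`, so what `fval`
  -- says about a tautology is irrelevant for the count.
  base i := if IsProper w i then 2 ^ (w.length + 2) else 1
  base_pos i := by split <;> positivity
  rank_inj i hi j hj hij := by
    have := congrArg (· % (w.length + 2)) hij
    simpa [Nat.mod_eq_of_lt hi, Nat.mod_eq_of_lt hj] using this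
  nest := by
    rintro k i - j - ⟨p, hp, rfl⟩ ⟨q, hq, hqp⟩
    have hpV := (hV _).2 ⟨i, hp.hasVar⟩
    have hqV := (hV _).2 ⟨j, hq.hasVar⟩
    have hpq := h.inj _ hqV _ hpV hqp
    refine (h.nested _ hpV i j hp.hasVar (hpq ▸ hq.hasVar)).imp ?_ ?_
    all_goals
      rintro h' l hl ⟨q', hq', rfl⟩
      obtain ⟨q'', hq'', he⟩ := h' _ hl hq'.hasVar
      exact ⟨q'', hq'', by rw [he]⟩
  rank_lt := by
    rintro k i hi j hj hij ⟨l, hl, hjl, hil⟩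
    have := sum_two_pow_lt (A := {l ∈ range (w.length + 2) | HasLevel w τ i l})
      (B := {l ∈ range (w.length + 2) | HasLevel w τ j l}) (k := k)
      (fun l hl hkl => by
        rw [mem_filter] at hl ⊢
        exact ⟨hl.1, hij l hkl hl.2⟩)
      ⟨l, by simpa [hjl] using h.hasLevel_lt hcard hjl, hl, by simp [hil]⟩
    nlinarith

/-! ### The rounds of the elimination -/

/-- The clause `i` contains the variable with the elimination time `e`. The expression `e` is
evaluated under one more variable. -/
def hasLevelE (i : ℕ) (e : Ex) : Ex := (inClauseE 0 (i + 1) * (arr 1 (var 0)).eq e).ex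

/-- The clause `i` contains the variable with the elimination time `e` positively. -/
def posLevelE (i : ℕ) (e : Ex) : Ex :=
  (inClauseE 0 (i + 1) * (arr 1 (var 0)).eq e * (inp 0 - 2 * (inp 0 / 2)).eq 1).ex

/-- The number of the round. -/
def roundE : Ex := arr 3 0

/-- The clause `var 0` is subsumed by the clause `var 1` in this round. -/
def subsumedE : Ex :=
  hasLevelE 0 roundE * ((roundE.lt (var 0) * hasLevelE 1 (var 1)).imp
    (hasLevelE 2 (var 1) * (posLevelE 2 (var 1)).iff (posLevelE 1 (var 1)))).all

/-- The numerator of the sum over both values of a variable of the products of the weights of the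
clauses that satisfy `c`. -/
def splitE (c : Ex) : Ex :=
  -- The value `false` falsifies positive occurrences. A selected clause that the value does not
  -- falsify has the factor `1`, written with its own denominator as numerator.
  .agg true (c.ite ((posLevelE 0 roundE).ite (arr 4 (var 0)) (arr 5 (var 0))) 1) +
  .agg true (c.ite ((posLevelE 0 roundE).ite (arr 5 (var 0)) (arr 4 (var 0))) 1)

/-- The numerator of the new weight of a clause. -/
def numE : Ex := (hasLevelE 0 roundE).ite
  (splitE (((arr 11 (var 0)).lt (arr 11 (var 1)) + (var 0).eq (var 1)) * subsumedE)) (arr 4 (var 0))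

/-- The denominator of the new weight of a clause. -/
def denE : Ex := (hasLevelE 0 roundE).ite
  -- In the quotient of the two splits the common denominators cancel except for that of the clause
  -- itself.
  (splitE ((arr 11 (var 0)).lt (arr 11 (var 1)) * subsumedE) * arr 5 (var 0)) (arr 5 (var 0))

variable {w : List ℕ} {s : ArrState} {ρ : ℕ → ℕ} {τ : ℕ → ℕ}

theorem holds_hasLevelE (hτ : HoldsTimes w s τ) {i k : ℕ} {e : Ex}
    (he : ∀ p, e.eval w s (push p ρ) = k) :
    (hasLevelE i e).Holds w s ρ ↔ HasLevel w τ (ρ i) k := by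
  simp only [hasLevelE, holds_ex, holds_mul, holds_inClauseE, holds_eq, eval_arr, eval_var,
    push_zero, push_succ, he, HasLevel]
  exact ⟨fun ⟨p, hp, h₁, h₂⟩ => ⟨p, h₁, by rw [← hτ p hp, h₂]⟩,
    fun ⟨p, h₁, h₂⟩ => ⟨p, h₁.lt.1, h₁, by rw [hτ p h₁.lt.1, h₂]⟩⟩

theorem holds_posLevelE (hτ : HoldsTimes w s τ) {i k : ℕ} {e : Ex}
    (he : ∀ p, e.eval w s (push p ρ) = k) :
    (posLevelE i e).Holds w s ρ ↔ PosLevel w τ (ρ i) k := by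
  simp only [posLevelE, holds_ex, holds_mul, holds_inClauseE, holds_eq, eval_arr, eval_var,
    push_zero, push_succ, he, PosLevel, eval_sub, eval_inp, eval_mul, eval_div, eval_two, eval_one]
  have hmod : ∀ x : ℕ, x - 2 * (x / 2) = x % 2 := by omega
  simp only [hmod]
  exact ⟨fun ⟨p, hp, ⟨h₁, h₂⟩, h₃⟩ => ⟨p, h₁, by rw [← hτ p hp, h₂], h₃⟩,
    fun ⟨p, h₁, h₂, h₃⟩ => ⟨p, h₁.lt.1, ⟨h₁, by rw [hτ p h₁.lt.1, h₂]⟩, h₃⟩⟩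

theorem eval_roundE : roundE.eval w s ρ = s 3 0 := rfl

/-- The numerator of a sum of products of fractions. -/
noncomputable def natSplit (S : ClauseSystem) (p q : ℕ → ℕ) (k : ℕ) (J : Finset ℕ) : ℕ :=
  ∏ j ∈ J, (if S.fval j k = false then p j else q j) +
    ∏ j ∈ J, (if S.fval j k = true then p j else q j)

theorem natSplit_pos {S : ClauseSystem} {p q : ℕ → ℕ} {k : ℕ} {J : Finset ℕ}
    (hp : ∀ j ∈ J, 0 < p j) (hq : ∀ j ∈ J, 0 < q j) : 0 < natSplit S p q k J := by
  refine Nat.add_pos_left (prod_pos fun j hj => ?_) _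
  split
  · exact hp j hj
  · exact hq j hj

theorem natSplit_le {S : ClauseSystem} {p q : ℕ → ℕ} {k n b : ℕ} {J : Finset ℕ} (hJ : J.card ≤ n)
    (hp : ∀ j ∈ J, p j ≤ 2 ^ b) (hq : ∀ j ∈ J, q j ≤ 2 ^ b) :
    natSplit S p q k J ≤ 2 ^ (b * n + 1) := by
  have key : ∀ (c : ℕ → Prop) [DecidablePred c], ∏ j ∈ J, (if c j then p j else q j) ≤ 2 ^ (b * n) := by
    intro c _
    calc _ ≤ (2 ^ b) ^ J.card := by
          refine prod_le_pow_card _ _ _ fun j hj => ?_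
          split
          · exact hp j hj
          · exact hq j hj
      _ = 2 ^ (b * J.card) := (pow_mul _ _ _).symm
      _ ≤ _ := Nat.pow_le_pow_right (by norm_num) (Nat.mul_le_mul_left _ hJ)
  have h₁ := key fun j => S.fval j k = false
  have h₂ := key fun j => S.fval j k = true
  rw [pow_succ, natSplit]
  omega

/-- Writing each missing factor `1` as `q j / q j` gives both summands the same denominator. -/
theorem split_eq_natSplit_div {S : ClauseSystem} {p q : ℕ → ℕ} {k : ℕ} {J : Finset ℕ} {x : ℕ → ℚ}
    (hq : ∀ j ∈ J, 0 < q j) (hx : ∀ j ∈ J, x j = (p j : ℚ) / q j) :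
    S.split x k J = (natSplit S p q k J : ℚ) / ∏ j ∈ J, (q j : ℚ) := by
  have key : ∀ b : Bool, ∏ j ∈ J with S.fval j k = b, x j =
      (∏ j ∈ J, ((if S.fval j k = b then p j else q j : ℕ) : ℚ)) / ∏ j ∈ J, (q j : ℚ) := by
    intro b
    rw [prod_filter, ← prod_div_distrib]
    refine prod_congr rfl fun j hj => ?_
    have : (q j : ℚ) ≠ 0 := by exact_mod_cast (hq j hj).ne'
    split
    · exact hx j hj
    · rw [div_self this]
  rw [ClauseSystem.split, key, key, ← add_div, natSplit]
  push_cast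
  rfl

section Round

variable {V : Finset ℕ} {hV : ∀ v, v ∈ V ↔ ∃ i, HasVar w i v} {hcard : V.card < w.length + 2}
  {h : IsOrder w V τ}

/-- The contents of the arrays after `k` rounds. -/
structure IsRound (w : List ℕ) (S : ClauseSystem) (τ : ℕ → ℕ) (s : ArrState) (k : ℕ) : Prop where
  times : HoldsTimes w s τ
  round : s 3 0 = k
  rank : ∀ i < w.length + 2, s 11 i = S.rank i
  coprime : ∀ i < w.length + 2, (s 4 i).Coprime (s 5 i)
  den_pos : ∀ i < w.length + 2, 0 < s 5 i
  weight : ∀ i < w.length + 2, S.weight k i = (s 4 i : ℚ) / s 5 i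

theorem holds_subsumedE {k : ℕ} (hs : HoldsTimes w s τ) (hk : s 3 0 = k) :
    subsumedE.Holds w s ρ ↔ (clauseSystem w hV hcard h).Subsumed k (ρ 0) (ρ 1) := by
  rw [subsumedE, holds_mul, holds_hasLevelE (k := k) (e := roundE) hs fun _ => hk, holds_all]
  refine and_congr_right fun _ => ?_
  have hl : ∀ l, (hasLevelE 1 (var 1)).Holds w s (push l ρ) ↔ HasLevel w τ (ρ 0) l :=
    fun l => holds_hasLevelE hs fun _ => rfl
  have hl' : ∀ l, (hasLevelE 2 (var 1)).Holds w s (push l ρ) ↔ HasLevel w τ (ρ 1) l :=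
    fun l => holds_hasLevelE hs fun _ => rfl
  have hp : ∀ l, (posLevelE 1 (var 1)).Holds w s (push l ρ) ↔ PosLevel w τ (ρ 0) l :=
    fun l => holds_posLevelE hs fun _ => rfl
  have hp' : ∀ l, (posLevelE 2 (var 1)).Holds w s (push l ρ) ↔ PosLevel w τ (ρ 1) l :=
    fun l => holds_posLevelE hs fun _ => rfl
  have hb : ∀ P Q : Prop, ((!decide P) = !decide Q) ↔ (P ↔ Q) := by
    intro P Q
    by_cases P <;> by_cases Q <;> simp [*]
  simp only [holds_imp, holds_mul, holds_iff, holds_lt, hl, hl', hp, hp', eval_roundE, hk,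
    eval_var, push_zero, clauseSystem, hb, and_imp]
  exact ⟨fun H l hkl hl => H l (h.hasLevel_lt hcard hl) hkl hl, fun H l _ => H l⟩

theorem eval_splitE {k i : ℕ} (hs : HoldsTimes w s τ) (hk : s 3 0 = k) {c : Ex} {J : Finset ℕ}
    (hJ : ∀ j < w.length + 2, c.Holds w s (push j fun _ => i) ↔ j ∈ J)
    (hJ' : J ⊆ range (w.length + 2)) :
    (splitE c).eval w s (fun _ => i) =
      natSplit (clauseSystem w hV hcard h) (s 4) (s 5) k J := by
  have hpos : ∀ j, (posLevelE 0 roundE).Holds w s (push j fun _ => i) ↔ PosLevel w τ j k :=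
    fun j => holds_posLevelE hs fun _ => hk
  have key : ∀ f : ℕ → ℕ, (∏ j ∈ range (w.length + 2),
      if c.Holds w s (push j fun _ => i) then f j else 1) = ∏ j ∈ J, f j := by
    intro f
    rw [← prod_filter]
    congr 1
    ext j
    rw [mem_filter, mem_range]
    exact ⟨fun h => (hJ j h.1).1 h.2, fun h => ⟨mem_range.1 (hJ' h),
      (hJ j (mem_range.1 (hJ' h))).2 h⟩⟩
  simp only [splitE, eval_add, eval_agg_true, eval_ite, eval_arr, eval_var, push_zero, eval_one,
    hpos, key, natSplit, clauseSystem, Bool.not_eq_false', Bool.not_eq_true', decide_eq_true_eq,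
    decide_eq_false_iff_not, ite_not]

theorem eval_numE {k i : ℕ} (hs : IsRound w (clauseSystem w hV hcard h) τ s k)
    (hi : i < w.length + 2) :
    numE.eval w s (fun _ => i) = if HasLevel w τ i k then
      natSplit (clauseSystem w hV hcard h) (s 4) (s 5) k
        (insert i ((clauseSystem w hV hcard h).below k i)) else s 4 i := by
  rw [numE, eval_ite]
  refine ite_congr (propext (holds_hasLevelE hs.times fun _ => hs.round)) (fun hik => ?_)
    fun _ => rfl
  refine eval_splitE hs.times hs.round (fun j hj => ?_) ?_
  · simp only [holds_mul, holds_add, holds_lt, holds_eq, eval_arr, eval_var, push_zero,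
      hs.rank j hj, show push j (fun _ => i) 1 = i from rfl, hs.rank i hi,
      holds_subsumedE (hV := hV) (hcard := hcard) (h := h) hs.times hs.round, mem_insert,
      ClauseSystem.below, mem_filter, mem_range]
    constructor
    · rintro ⟨h₁ | h₁, h₂⟩
      · exact .inr ⟨hj, h₁, h₂⟩
      · exact .inl h₁
    · rintro (rfl | ⟨-, h₁, h₂⟩)
      · exact ⟨.inr rfl, hik, fun l _ hl => ⟨hl, rfl⟩⟩
      · exact ⟨.inl h₁, h₂⟩
  · exact insert_subset (by simpa using hi) (filter_subset _ _)

theorem eval_denE {k i : ℕ} (hs : IsRound w (clauseSystem w hV hcard h) τ s k)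
    (hi : i < w.length + 2) :
    denE.eval w s (fun _ => i) = if HasLevel w τ i k then
      natSplit (clauseSystem w hV hcard h) (s 4) (s 5) k
        ((clauseSystem w hV hcard h).below k i) * s 5 i else s 5 i := by
  rw [denE, eval_ite]
  refine ite_congr (propext (holds_hasLevelE hs.times fun _ => hs.round)) (fun hik => ?_)
    fun _ => rfl
  rw [eval_mul]
  refine congrArg₂ _ (eval_splitE hs.times hs.round (fun j hj => ?_) (filter_subset _ _)) rfl
  simp only [holds_mul, holds_lt, eval_arr, eval_var, push_zero,
    hs.rank j hj, show push j (fun _ => i) 1 = i from rfl, hs.rank i hi,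
    holds_subsumedE (hV := hV) (hcard := hcard) (h := h) hs.times hs.round,
    ClauseSystem.below, mem_filter, mem_range]
  exact ⟨fun h => ⟨hj, h⟩, fun h => h.2⟩

/-- The origin of the exponent `5` in the truncation. Reduced weights have numerators and
denominators at most `2 ^ (K + K * K)`; a new denominator is a sum of two products of at most `K` of
these numbers, times one more. -/
theorem pow_bound {K : ℕ} (hK : 2 ≤ K) : (K + K * K) * K + 1 + (K + K * K) ≤ K ^ 5 := by
  have h2 : 4 ≤ K * K := Nat.mul_le_mul hK hK
  have h3 : 2 * (K * K) ≤ K * K * K := by nlinarith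
  have h5 : 4 * (K * K * K) ≤ K ^ 5 := by
    calc 4 * (K * K * K) ≤ (K * K) * (K * K * K) := Nat.mul_le_mul_right _ h2
      _ = K ^ 5 := by ring
  nlinarith

/-- The numerators and denominators stay below the truncation. -/
theorem IsRound.bounds {k : ℕ} (hk : k < w.length + 2)
    (hs : IsRound w (clauseSystem w hV hcard h) τ s k) {i : ℕ} (hi : i < w.length + 2) :
    (0 < numE.eval w s (fun _ => i) ∧ numE.eval w s (fun _ => i) ≤ 2 ^ (w.length + 2) ^ 5) ∧
    (0 < denE.eval w s (fun _ => i) ∧ denE.eval w s (fun _ => i) ≤ 2 ^ (w.length + 2) ^ 5) ∧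
    (clauseSystem w hV hcard h).weight (k + 1) i =
      (numE.eval w s (fun _ => i) : ℚ) / denE.eval w s (fun _ => i) := by
  have hnum := eval_numE hs hi
  have hden := eval_denE hs hi
  set S := clauseSystem w hV hcard h with hS
  set K := w.length + 2 with hKdef
  have hB : ∀ i, S.base i ≤ 2 ^ K := by
    intro i
    simp only [hS, clauseSystem]
    split
    · exact le_rfl
    · exact Nat.one_le_two_pow
  -- Here it matters that the fractions are reduced: `le_of_weight_eq` gives the bound `2 ^ k * B ^
  -- K` with `B = 2 ^ K` and `k < K`, whatever the number of rounds so far.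
  have hbd : ∀ j < K, s 4 j ≤ 2 ^ (K + K * K) ∧ s 5 j ≤ 2 ^ (K + K * K) := by
    intro j hj
    have hle : 2 ^ k * (2 ^ K) ^ S.K ≤ 2 ^ (K + K * K) := by
      rw [← pow_mul, ← pow_add]
      exact Nat.pow_le_pow_right (by norm_num) (Nat.add_le_add_right hk.le _)
    have := ClauseSystem.le_of_weight_eq hB (i := j) hj (hs.coprime j hj) (hs.den_pos j hj)
      (hs.weight j hj)
    exact ⟨this.1.trans hle, this.2.trans hle⟩
  have hnum_pos : ∀ j < K, 0 < s 4 j := by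
    intro j hj
    have := S.weight_pos k j
    rw [hs.weight j hj] at this
    rcases Nat.eq_zero_or_pos (s 4 j) with h0 | h0
    · simp [h0] at this
    · exact h0
  have hsub : S.below k i ⊆ range K := filter_subset _ _
  have hsub' : insert i (S.below k i) ⊆ range K := insert_subset (by simpa using hi) hsub
  have hlt : ∀ {J : Finset ℕ}, J ⊆ range K → ∀ j ∈ J, j < K := fun hJ j hj => mem_range.1 (hJ hj)
  have hsplit_le : ∀ J ⊆ range K, natSplit S (s 4) (s 5) k J ≤ 2 ^ ((K + K * K) * K + 1) :=
    fun J hJ => natSplit_le (by simpa using card_le_card hJ) (fun j hj => (hbd j (hlt hJ j hj)).1)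
      fun j hj => (hbd j (hlt hJ j hj)).2
  have hsplit_pos : ∀ J ⊆ range K, 0 < natSplit S (s 4) (s 5) k J :=
    fun J hJ => natSplit_pos (fun j hj => hnum_pos j (hlt hJ j hj))
      fun j hj => hs.den_pos j (hlt hJ j hj)
  have hK := pow_bound (K := K) (by omega)
  rw [hnum, hden]
  by_cases hik : HasLevel w τ i k
  · rw [if_pos hik, if_pos hik]
    refine ⟨⟨hsplit_pos _ hsub', (hsplit_le _ hsub').trans
      (Nat.pow_le_pow_right (by norm_num) (by omega))⟩,
      ⟨Nat.mul_pos (hsplit_pos _ hsub) (hs.den_pos i hi), ?_⟩, ?_⟩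
    · refine (Nat.mul_le_mul (hsplit_le _ hsub) (hbd i hi).2).trans ?_
      rw [← pow_add]
      exact Nat.pow_le_pow_right (by norm_num) (by omega)
    · have hni : i ∉ S.below k i := by simp [ClauseSystem.below]
      rw [ClauseSystem.weight, if_pos (show S.has i k from hik),
        split_eq_natSplit_div (fun j hj => hs.den_pos j (hlt hsub' j hj))
          fun j hj => hs.weight j (hlt hsub' j hj),
        split_eq_natSplit_div (fun j hj => hs.den_pos j (hlt hsub j hj))
          fun j hj => hs.weight j (hlt hsub j hj), prod_insert hni]
      have h₁ : ∏ j ∈ S.below k i, (s 5 j : ℚ) ≠ 0 := prod_ne_zero_iff.2 fun j hj => by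
        exact_mod_cast (hs.den_pos j (hlt hsub j hj)).ne'
      have h₂ : (natSplit S (s 4) (s 5) k (S.below k i) : ℚ) ≠ 0 := by
        exact_mod_cast (hsplit_pos _ hsub).ne'
      have h₃ : (s 5 i : ℚ) ≠ 0 := by exact_mod_cast (hs.den_pos i hi).ne'
      push_cast
      field_simp
  · rw [if_neg hik, if_neg hik]
    have hle : 2 ^ (K + K * K) ≤ 2 ^ K ^ 5 := Nat.pow_le_pow_right (by norm_num) (by omega)
    refine ⟨⟨hnum_pos i hi, (hbd i hi).1.trans hle⟩, ⟨hs.den_pos i hi, (hbd i hi).2.trans hle⟩, ?_⟩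
    rw [ClauseSystem.weight, if_neg (show ¬ S.has i k from hik), hs.weight i hi]

end Round

/-! ### Reduction of fractions -/

/-- The `n`-fold iteration of `rep`. -/
def Stmt.repPow (p : Stmt) : ℕ → Stmt
  | 0 => p
  | n + 1 => .rep (p.repPow n)

theorem Stmt.exec_repPow (w : List ℕ) (p : Stmt) (n : ℕ) :
    (p.repPow n).exec w = (p.exec w)^[(w.length + 2) ^ n] := by
  induction n with
  | zero => simp [Stmt.repPow]
  | succ n ih =>
    funext s
    rw [Stmt.repPow, Stmt.exec, ih, ← Function.iterate_mul, pow_succ]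

/-- One step of the Euclidean algorithm on the arrays `6` and `7`. -/
def euclidStmt : Stmt :=
  .seq (.assign 8 (arr 6 (var 0) - arr 7 (var 0) * (arr 6 (var 0) / arr 7 (var 0))))
    (.seq (.assign 6 (arr 7 (var 0))) (.assign 7 (arr 8 (var 0))))

theorem exec_euclidStmt {i : ℕ} (hi : i < w.length + 2)
    (h6 : s 6 i ≤ 2 ^ (w.length + 2) ^ 5) (h7 : s 7 i ≤ 2 ^ (w.length + 2) ^ 5) :
    (euclidStmt.exec w s 6 i, euclidStmt.exec w s 7 i) = euclidStep (s 6 i, s 7 i) := by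
  have hmod : s 6 i - s 7 i * (s 6 i / s 7 i) = s 6 i % s 7 i := by
    have := Nat.mod_add_div (s 6 i) (s 7 i)
    omega
  have := Nat.mod_le (s 6 i) (s 7 i)
  simp [euclidStmt, Stmt.exec, hi, euclidStep, hmod, h7, this.trans h6]

theorem exec_euclidStmt_of_ne {a : Fin 14} (h6 : a ≠ 6) (h7 : a ≠ 7) (h8 : a ≠ 8) :
    euclidStmt.exec w s a = s a := by
  funext i
  simp [euclidStmt, Stmt.exec, h6, h7, h8]

theorem exec_euclidStmt_iterate (h6 : ∀ i < w.length + 2, s 6 i ≤ 2 ^ (w.length + 2) ^ 5)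
    (h7 : ∀ i < w.length + 2, s 7 i ≤ 2 ^ (w.length + 2) ^ 5) (n : ℕ) :
    (∀ i < w.length + 2, ((euclidStmt.exec w)^[n] s 6 i, (euclidStmt.exec w)^[n] s 7 i) =
      euclidStep^[n] (s 6 i, s 7 i)) ∧
    (∀ i < w.length + 2, (euclidStmt.exec w)^[n] s 6 i ≤ 2 ^ (w.length + 2) ^ 5 ∧
      (euclidStmt.exec w)^[n] s 7 i ≤ 2 ^ (w.length + 2) ^ 5) ∧
    ∀ a : Fin 14, a ≠ 6 → a ≠ 7 → a ≠ 8 → (euclidStmt.exec w)^[n] s a = s a := by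
  induction n with
  | zero => exact ⟨fun _ _ => rfl, fun i hi => ⟨h6 i hi, h7 i hi⟩, fun _ _ _ _ => rfl⟩
  | succ n ih =>
    obtain ⟨ih₁, ih₂, ih₃⟩ := ih
    simp only [Function.iterate_succ_apply']
    refine ⟨fun i hi => ?_, fun i hi => ?_, fun a h6 h7 h8 => ?_⟩
    · rw [exec_euclidStmt hi (ih₂ i hi).1 (ih₂ i hi).2, ih₁ i hi]
    · have := exec_euclidStmt hi (ih₂ i hi).1 (ih₂ i hi).2
      simp only [euclidStep, Prod.mk.injEq] at this
      rw [this.1, this.2]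
      exact ⟨(ih₂ i hi).2, (Nat.mod_le _ _).trans (ih₂ i hi).1⟩
    · rw [exec_euclidStmt_of_ne h6 h7 h8, ih₃ a h6 h7 h8]

/-- One round: compute the new weights and reduce the fractions. -/
def roundStmt : Stmt :=
  .seq (.seq (.assign 9 numE) (.seq (.assign 10 denE)
    (.seq (.assign 6 (arr 9 (var 0))) (.assign 7 (arr 10 (var 0))))))
  (.seq (euclidStmt.repPow 7)
    (.seq (.assign 4 (arr 9 (var 0) / (arr 6 (var 0) + arr 7 (var 0))))
      (.seq (.assign 5 (arr 10 (var 0) / (arr 6 (var 0) + arr 7 (var 0))))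
        (.assign 3 (arr 3 0 + 1)))))

end RAM

namespace RAM

open Ex SAT Finset
open scoped Classical

section Rounds

variable {w : List ℕ} {τ : ℕ → ℕ} {V : Finset ℕ} {hV : ∀ v, v ∈ V ↔ ∃ i, HasVar w i v}
  {hcard : V.card < w.length + 2} {h : IsOrder w V τ}

theorem IsRound.congr {S : ClauseSystem} {s s' : ArrState} {k : ℕ} (hs : IsRound w S τ s k)
    (h1 : s' 1 = s 1) (h3 : s' 3 = s 3) (h4 : s' 4 = s 4) (h5 : s' 5 = s 5) (h11 : s' 11 = s 11) :
    IsRound w S τ s' k where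
  times := by unfold HoldsTimes; rw [h1]; exact hs.times
  round := by rw [h3]; exact hs.round
  rank := by rw [h11]; exact hs.rank
  coprime := by rw [h4, h5]; exact hs.coprime
  den_pos := by rw [h5]; exact hs.den_pos
  weight := by rw [h4, h5]; exact hs.weight

theorem exec_assign_of_ne {s : ArrState} {a b : Fin 14} (hab : b ≠ a) (e : Ex) :
    (Stmt.assign a e).exec w s b = s b := by
  funext i; simp [Stmt.exec, hab]

theorem exec_assign {s : ArrState} {a : Fin 14} {e : Ex} {i x : ℕ} (hi : i < w.length + 2)
    (hx : e.eval w s (fun _ => i) = x) (hle : x ≤ 2 ^ (w.length + 2) ^ 5) :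
    (Stmt.assign a e).exec w s a i = x := by
  simp [Stmt.exec, hi, hx, hle]

theorem IsRound.exec {s : ArrState} {k : ℕ} (hk : k < w.length + 2)
    (hs : IsRound w (clauseSystem w hV hcard h) τ s k) :
    IsRound w (clauseSystem w hV hcard h) τ (roundStmt.exec w s) (k + 1) := by
  have hpow := len_lt_pow w
  have hK2 : 2 ≤ w.length + 2 := by omega
  obtain ⟨num, hnum⟩ : ∃ num : ℕ → ℕ, ∀ i, numE.eval w s (fun _ => i) = num i := ⟨_, fun _ => rfl⟩
  obtain ⟨den, hden⟩ : ∃ den : ℕ → ℕ, ∀ i, denE.eval w s (fun _ => i) = den i := ⟨_, fun _ => rfl⟩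
  have hb := fun i (hi : i < w.length + 2) => hs.bounds hk hi
  simp only [hnum, hden] at hb
  set t₁ := (Stmt.assign 9 numE).exec w s with ht₁
  have ht₁s : ∀ a, a ≠ 9 → t₁ a = s a := fun a ha => exec_assign_of_ne ha _
  have ht₁9 : ∀ i < w.length + 2, t₁ 9 i = num i := fun i hi =>
    exec_assign hi (hnum i) (hb i hi).1.2
  have hst₁ : IsRound w (clauseSystem w hV hcard h) τ t₁ k := hs.congr (ht₁s _ (by decide))
    (ht₁s _ (by decide)) (ht₁s _ (by decide)) (ht₁s _ (by decide)) (ht₁s _ (by decide))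
  set t₂ := (Stmt.assign 10 denE).exec w t₁ with ht₂
  have ht₂s : ∀ a, a ≠ 10 → t₂ a = t₁ a := fun a ha => exec_assign_of_ne ha _
  have ht₂10 : ∀ i < w.length + 2, t₂ 10 i = den i := fun i hi => by
    refine exec_assign hi ?_ (hb i hi).2.1.2
    -- The denominator is computed after array `9` has changed, but the weights in arrays `4` and
    -- `5` are still the old ones.
    rw [← hden, eval_denE hst₁ hi, eval_denE hs hi, ht₁s 4 (by decide), ht₁s 5 (by decide)]
  set t₃ := (Stmt.assign 6 (arr 9 (var 0))).exec w t₂ with ht₃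
  have ht₃s : ∀ a, a ≠ 6 → t₃ a = t₂ a := fun a ha => exec_assign_of_ne ha _
  have ht₃6 : ∀ i < w.length + 2, t₃ 6 i = num i := fun i hi => by
    refine exec_assign hi ?_ (hb i hi).1.2
    rw [eval_arr, eval_var, ht₂s 9 (by decide), ht₁9 i hi]
  set t₄ := (Stmt.assign 7 (arr 10 (var 0))).exec w t₃ with ht₄
  have ht₄s : ∀ a, a ≠ 7 → t₄ a = t₃ a := fun a ha => exec_assign_of_ne ha _
  have ht₄7 : ∀ i < w.length + 2, t₄ 7 i = den i := fun i hi => by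
    refine exec_assign hi ?_ (hb i hi).2.1.2
    rw [eval_arr, eval_var, ht₃s 10 (by decide), ht₂10 i hi]
  have ht₄6 : ∀ i < w.length + 2, t₄ 6 i = num i := fun i hi => by
    rw [ht₄s 6 (by decide), ht₃6 i hi]
  obtain ⟨hg, -, ht₅s⟩ := exec_euclidStmt_iterate (w := w) (s := t₄)
    (fun i hi => by rw [ht₄6 i hi]; exact (hb i hi).1.2)
    (fun i hi => by rw [ht₄7 i hi]; exact (hb i hi).2.1.2) ((w.length + 2) ^ 7)
  rw [← Stmt.exec_repPow] at hg ht₅s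
  set t₅ := (euclidStmt.repPow 7).exec w t₄ with ht₅
  have ht₅g : ∀ i < w.length + 2, t₅ 6 i + t₅ 7 i = (num i).gcd (den i) := by
    intro i hi
    have := hg i hi
    rw [ht₄6 i hi, ht₄7 i hi] at this
    rw [show t₅ 6 i + t₅ 7 i = (t₅ 6 i, t₅ 7 i).1 + (t₅ 6 i, t₅ 7 i).2 from rfl, this]
    -- Numerator and denominator are at most `2 ^ len ^ 5`, so more than `2 * len ^ 5 + 1` steps are
    -- enough; `len ^ 7 ≥ 4 * len ^ 5` exceeds this.
    refine euclidStep_iterate_add (m := 2 * (w.length + 2) ^ 5 + 1) ?_ ?_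
    · have h5 : 1 ≤ (w.length + 2) ^ 5 := Nat.one_le_pow _ _ (by omega)
      have h2 : 2 ^ 2 ≤ (w.length + 2) ^ 2 := Nat.pow_le_pow_left hK2 2
      rw [show (7 : ℕ) = 2 + 5 by norm_num, pow_add]
      nlinarith
    · calc num i * den i ≤ 2 ^ (w.length + 2) ^ 5 * 2 ^ (w.length + 2) ^ 5 :=
            Nat.mul_le_mul (hb i hi).1.2 (hb i hi).2.1.2
        _ = 2 ^ (2 * (w.length + 2) ^ 5) := by rw [← pow_add, two_mul]
        _ < _ := Nat.pow_lt_pow_right (by norm_num) (by omega)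
  have ht₅num : ∀ i < w.length + 2, t₅ 9 i = num i := fun i hi => by
    rw [ht₅s 9 (by decide) (by decide) (by decide), ht₄s 9 (by decide), ht₃s 9 (by decide),
      ht₂s 9 (by decide), ht₁9 i hi]
  have ht₅den : ∀ i < w.length + 2, t₅ 10 i = den i := fun i hi => by
    rw [ht₅s 10 (by decide) (by decide) (by decide), ht₄s 10 (by decide), ht₃s 10 (by decide),
      ht₂10 i hi]
  have ht₅old : ∀ a : Fin 14, a ≠ 6 → a ≠ 7 → a ≠ 8 → a ≠ 9 → a ≠ 10 → t₅ a = s a :=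
    fun a h6 h7 h8 h9 h10 => by
      rw [ht₅s a h6 h7 h8, ht₄s a h7, ht₃s a h6, ht₂s a h10, ht₁s a h9]
  set t₆ := (Stmt.assign 4 (arr 9 (var 0) / (arr 6 (var 0) + arr 7 (var 0)))).exec w t₅ with ht₆
  have ht₆s : ∀ a, a ≠ 4 → t₆ a = t₅ a := fun a ha => exec_assign_of_ne ha _
  have ht₆4 : ∀ i < w.length + 2, t₆ 4 i = num i / (num i).gcd (den i) := fun i hi => by
    refine exec_assign hi ?_ ((Nat.div_le_self _ _).trans (hb i hi).1.2)
    simp only [eval_div, eval_add, eval_arr, eval_var, ht₅num i hi, ht₅g i hi]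
  set t₇ := (Stmt.assign 5 (arr 10 (var 0) / (arr 6 (var 0) + arr 7 (var 0)))).exec w t₆ with ht₇
  have ht₇s : ∀ a, a ≠ 5 → t₇ a = t₆ a := fun a ha => exec_assign_of_ne ha _
  have ht₇5 : ∀ i < w.length + 2, t₇ 5 i = den i / (num i).gcd (den i) := fun i hi => by
    refine exec_assign hi ?_ ((Nat.div_le_self _ _).trans (hb i hi).2.1.2)
    simp only [eval_div, eval_add, eval_arr, eval_var, ht₆s _ (show (10 : Fin 14) ≠ 4 by decide),
      ht₆s _ (show (6 : Fin 14) ≠ 4 by decide), ht₆s _ (show (7 : Fin 14) ≠ 4 by decide),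
      ht₅den i hi, ht₅g i hi]
  have hexec : roundStmt.exec w s = (Stmt.assign 3 (arr 3 0 + 1)).exec w t₇ := rfl
  rw [hexec]
  set t₈ := (Stmt.assign 3 (arr 3 0 + 1)).exec w t₇ with ht₈
  have ht₈s : ∀ a, a ≠ 3 → t₈ a = t₇ a := fun a ha => exec_assign_of_ne ha _
  have hgpos : ∀ i < w.length + 2, 0 < (num i).gcd (den i) := fun i hi =>
    Nat.gcd_pos_of_pos_left _ (hb i hi).1.1
  have h4 : ∀ i < w.length + 2, t₈ 4 i = num i / (num i).gcd (den i) := fun i hi => by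
    rw [ht₈s 4 (by decide), ht₇s 4 (by decide), ht₆4 i hi]
  have h5 : ∀ i < w.length + 2, t₈ 5 i = den i / (num i).gcd (den i) := fun i hi => by
    rw [ht₈s 5 (by decide), ht₇5 i hi]
  refine ⟨fun p hp => ?_, ?_, fun i hi => ?_, fun i hi => ?_, fun i hi => ?_, fun i hi => ?_⟩
  · rw [ht₈s 1 (by decide), ht₇s 1 (by decide), ht₆s 1 (by decide), ht₅old 1 (by decide) (by decide)
      (by decide) (by decide) (by decide)]
    exact hs.times p hp
  · refine exec_assign (by omega) ?_ (by omega)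
    rw [eval_add, eval_arr, eval_zero, eval_one, ht₇s 3 (by decide), ht₆s 3 (by decide),
      ht₅old 3 (by decide) (by decide) (by decide) (by decide) (by decide), hs.round]
  · rw [ht₈s 11 (by decide), ht₇s 11 (by decide), ht₆s 11 (by decide), ht₅old 11 (by decide)
      (by decide) (by decide) (by decide) (by decide)]
    exact hs.rank i hi
  · rw [h4 i hi, h5 i hi]
    exact Nat.coprime_div_gcd_div_gcd (hgpos i hi)
  · rw [h5 i hi]
    exact Nat.div_pos (Nat.gcd_le_right _ (hb i hi).2.1.1) (hgpos i hi)
  · rw [h4 i hi, h5 i hi, (hb i hi).2.2, Nat.cast_div (Nat.gcd_dvd_left _ _)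
      (by exact_mod_cast (hgpos i hi).ne'), Nat.cast_div (Nat.gcd_dvd_right _ _)
      (by exact_mod_cast (hgpos i hi).ne')]
    have : ((num i).gcd (den i) : ℚ) ≠ 0 := by exact_mod_cast (hgpos i hi).ne'
    have : (den i : ℚ) ≠ 0 := by exact_mod_cast (hb i hi).2.1.1.ne'
    field_simp

/-! ### The counting program -/

/-- The end marker of a clause that is not a tautology. -/
def properE : Ex :=
  (var 0).lt (len - 2) * (inp 0).eq 0 * ((inClauseE 1 2 * inClauseE 0 2 *
    (varAtE 1).eq (varAtE 0)).imp ((inp 1).eq (inp 0))).all.all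

/-- The rank of a clause. -/
def rankE : Ex :=
  len * .agg false ((hasLevelE 1 (var 1)).ite (.agg true (((var 0).lt (var 1)).ite 2 1)) 0) + var 0

/-- Initialize the ranks and weights. -/
def initStmt : Stmt :=
  .seq (.assign 11 rankE) (.seq (.assign 4 (properE.ite (.bound 1) 1))
    (.seq (.assign 5 1) (.assign 3 0)))

/-- The weighted number of all assignments. -/
def totalE : Ex :=
  .agg true ((hasLevelE 0 (var 2)).ex.ite 2 1) * .agg true (arr 4 (var 0)) /
    .agg true (arr 5 (var 0))

/-- The program that counts the satisfying assignments. -/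
def countStmt : Stmt :=
  .seq orderStmt (.seq initStmt (.seq (.rep roundStmt)
    (.assign 0 (totalE - totalE / .bound 1 * .bound 1))))

theorem holds_properE {s : ArrState} {i : ℕ} :
    properE.Holds w s (fun _ => i) ↔ IsProper w i := by
  simp only [properE, holds_mul, holds_lt, holds_eq, holds_all, holds_imp, holds_inClauseE,
    eval_varAtE, eval_inp, eval_var, eval_sub, eval_len, eval_two, eval_zero, push_zero, push_succ,
    IsProper, Nat.add_sub_cancel, and_assoc]
  refine and_congr_right fun _ => and_congr_right fun _ => ?_
  exact ⟨fun H p q hp hq hpq => H p hp.lt.1 q hq.lt.1 ⟨hp, hq, hpq⟩,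
    fun H p _ q _ hpq => H p q hpq.1 hpq.2.1 hpq.2.2⟩

theorem isRound_exec_initStmt {s : ArrState} (hs : HoldsTimes w s τ) :
    IsRound w (clauseSystem w hV hcard h) τ (initStmt.exec w s) 0 := by
  have hpow := len_lt_pow w
  set t₁ := (Stmt.assign 11 rankE).exec w s with ht₁
  have ht₁s : ∀ a, a ≠ 11 → t₁ a = s a := fun a ha => exec_assign_of_ne ha _
  set t₂ := (Stmt.assign 4 (properE.ite (.bound 1) 1)).exec w t₁ with ht₂
  have ht₂s : ∀ a, a ≠ 4 → t₂ a = t₁ a := fun a ha => exec_assign_of_ne ha _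
  set t₃ := (Stmt.assign 5 1).exec w t₂ with ht₃
  have ht₃s : ∀ a, a ≠ 5 → t₃ a = t₂ a := fun a ha => exec_assign_of_ne ha _
  have hexec : initStmt.exec w s = (Stmt.assign 3 0).exec w t₃ := rfl
  rw [hexec]
  set t₄ := (Stmt.assign 3 0).exec w t₃ with ht₄
  have ht₄s : ∀ a, a ≠ 3 → t₄ a = t₃ a := fun a ha => exec_assign_of_ne ha _
  have h4 : ∀ i < w.length + 2, t₄ 4 i = (clauseSystem w hV hcard h).base i := by
    intro i hi
    rw [ht₄s 4 (by decide), ht₃s 4 (by decide)]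
    refine exec_assign hi ?_ ?_
    · rw [eval_ite, eval_bound, pow_one, eval_one]
      exact if_congr holds_properE rfl rfl
    · have : (w.length + 2) ^ 1 ≤ (w.length + 2) ^ 5 := Nat.pow_le_pow_right (by omega) (by omega)
      rw [pow_one] at this
      simp only [clauseSystem]
      split
      · exact Nat.pow_le_pow_right (by norm_num) this
      · exact Nat.one_le_two_pow
  have h5 : ∀ i < w.length + 2, t₄ 5 i = 1 := by
    intro i hi
    rw [ht₄s 5 (by decide)]
    exact exec_assign hi rfl Nat.one_le_two_pow
  refine ⟨fun p hp => ?_, ?_, fun i hi => ?_, fun i hi => ?_, fun i hi => ?_, fun i hi => ?_⟩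
  · rw [ht₄s 1 (by decide), ht₃s 1 (by decide), ht₂s 1 (by decide), ht₁s 1 (by decide)]
    exact hs p hp
  · exact exec_assign (by omega) rfl (Nat.zero_le _)
  · rw [ht₄s 11 (by decide), ht₃s 11 (by decide), ht₂s 11 (by decide)]
    refine exec_assign hi ?_ ?_
    · simp only [rankE, eval_add, eval_mul, eval_len, eval_var, eval_agg_false, eval_ite,
        eval_agg_true, holds_lt, eval_two, eval_one, eval_zero, push_zero, clauseSystem,
        show ∀ p q : ℕ, push p (push q fun _ => i) 1 = q from fun _ _ => rfl]
      rw [sum_filter]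
      congr 2
      refine sum_congr rfl fun l hl => if_congr (holds_hasLevelE hs fun _ => rfl) ?_ rfl
      rw [prod_ite, prod_const_one, mul_one, prod_const]
      congr 1
      rw [show {x ∈ range (w.length + 2) | x < l} = range l from ?_, card_range]
      ext x
      have := mem_range.1 hl
      simp only [mem_filter, mem_range]
      omega
    · have h₁ : ∑ l ∈ range (w.length + 2) with HasLevel w τ i l, 2 ^ l < 2 ^ (w.length + 2) :=
        Nat.geomSum_lt le_rfl fun l hl => mem_range.1 (mem_filter.1 hl).1
      have h₂ : w.length + 2 < 2 ^ (w.length + 2) := Nat.lt_two_pow_self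
      have h₃ : 2 ^ (w.length + 2) * 2 ^ (w.length + 2) ≤ 2 ^ (w.length + 2) ^ 5 := by
        rw [← pow_add]
        refine Nat.pow_le_pow_right (by norm_num) ?_
        have : (w.length + 2) ^ 2 ≤ (w.length + 2) ^ 5 := Nat.pow_le_pow_right (by omega) (by omega)
        nlinarith
      simp only [clauseSystem]
      nlinarith
  · rw [h5 i hi]; exact Nat.coprime_one_right _
  · rw [h5 i hi]; exact Nat.one_pos
  · rw [h4 i hi, h5 i hi, ClauseSystem.weight]; simp

variable (hV hcard h) in
/-- The weighted number of all assignments to the variables. -/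
noncomputable def totalWeight : ℕ :=
  ∑ t ∈ {l ∈ range (w.length + 2) | (clauseSystem w hV hcard h).Used l}.powerset,
    ∏ j ∈ range (w.length + 2) with
      (clauseSystem w hV hcard h).Falsified 0 j fun l => decide (l ∈ t),
        (clauseSystem w hV hcard h).base j

theorem eval_totalE {s : ArrState} {ρ : ℕ → ℕ}
    (hs : IsRound w (clauseSystem w hV hcard h) τ s (w.length + 2)) :
    totalE.eval w s ρ = totalWeight hV hcard h := by
  have hpos : 0 < ∏ j ∈ range (w.length + 2), s 5 j :=
    prod_pos fun j hj => hs.den_pos j (mem_range.1 hj)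
  have hused : ∏ l ∈ range (w.length + 2),
      (if (clauseSystem w hV hcard h).Used l then 2 else 1 : ℕ) =
      2 ^ #{l ∈ range (w.length + 2) | (clauseSystem w hV hcard h).Used l} := by
    rw [prod_ite, prod_const_one, mul_one, prod_const]
  have heval : totalE.eval w s ρ =
      (2 ^ #{l ∈ range (w.length + 2) | (clauseSystem w hV hcard h).Used l} *
        ∏ j ∈ range (w.length + 2), s 4 j) / ∏ j ∈ range (w.length + 2), s 5 j := by
    simp only [totalE, eval_div, eval_mul, eval_agg_true, eval_ite, eval_arr, eval_var, push_zero,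
      eval_two, eval_one]
    rw [← hused]
    congr 2
    refine prod_congr rfl fun l hl => if_congr ?_ rfl rfl
    rw [holds_ex]
    exact exists_congr fun i => and_congr_right fun _ => holds_hasLevelE hs.times fun _ => rfl
  rw [heval]
  -- The division is exact, because the rational product equals the natural number `totalWeight`.
  refine Nat.div_eq_of_eq_mul_left hpos ?_
  have := ClauseSystem.two_pow_mul_prod_weight (S := clauseSystem w hV hcard h)
    (n := w.length + 2) fun i _ l hl => h.hasLevel_lt hcard hl
  have hw : ∏ j ∈ range (clauseSystem w hV hcard h).K,
      (clauseSystem w hV hcard h).weight (w.length + 2) j =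
      (∏ j ∈ range (w.length + 2), (s 4 j : ℚ)) / ∏ j ∈ range (w.length + 2), (s 5 j : ℚ) := by
    rw [← prod_div_distrib]
    exact prod_congr rfl fun j hj => hs.weight j (mem_range.1 hj)
  have hpos' : ∏ j ∈ range (w.length + 2), (s 5 j : ℚ) ≠ 0 := by exact_mod_cast hpos.ne'
  rw [hw, ← mul_div_assoc, div_eq_iff hpos'] at this
  exact_mod_cast this

/-- Modulo `2 ^ len`, only the satisfying assignments count. -/
theorem totalWeight_mod : totalWeight hV hcard h % 2 ^ (w.length + 2) =
    #{t ∈ {l ∈ range (w.length + 2) | (clauseSystem w hV hcard h).Used l}.powerset |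
      ∀ j, IsProper w j →
        ¬ (clauseSystem w hV hcard h).Falsified 0 j fun l => decide (l ∈ t)} := by
  set U := {l ∈ range (w.length + 2) | (clauseSystem w hV hcard h).Used l} with hU
  have hUV : U ⊆ V.image τ := by
    intro l hl
    obtain ⟨i, -, p, hp, rfl⟩ := (mem_filter.1 hl).2
    exact mem_image_of_mem _ ((hV _).2 ⟨i, hp.hasVar⟩)
  -- There are at most as many used levels as variables; this keeps the count below the modulus.
  have hUlt : #U < w.length + 2 := ((card_le_card hUV).trans card_image_le).trans_lt hcard
  have hlt : #{t ∈ U.powerset | ∀ j, IsProper w j →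
        ¬ (clauseSystem w hV hcard h).Falsified 0 j fun l => decide (l ∈ t)} < 2 ^ (w.length + 2) := by
    refine (card_filter_le _ _).trans_lt ?_
    rw [card_powerset]
    exact Nat.pow_lt_pow_right (by norm_num) hUlt
  rw [← Nat.mod_eq_of_lt hlt]
  change _ ≡ _ [MOD _]
  rw [totalWeight, card_filter]
  refine Nat.ModEq.sum fun t _ => ?_
  split
  · next hsat =>
    rw [prod_eq_one]
    intro j hj
    exact if_neg fun hj' => hsat j hj' (mem_filter.1 hj).2
  · next hsat =>
    push Not at hsat
    obtain ⟨j, hj, hf⟩ := hsat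
    -- A single falsified proper clause already contributes the factor `2 ^ len`.
    refine Nat.modEq_zero_iff_dvd.2 ?_
    have : (clauseSystem w hV hcard h).base j = 2 ^ (w.length + 2) := if_pos hj
    rw [← this]
    exact dvd_prod_of_mem _ (mem_filter.2 ⟨mem_range.2 (by have := hj.1; omega), hf⟩)

end Rounds

theorem exec_countStmt {w : List ℕ} {V : Finset ℕ} (hV : ∀ v, v ∈ V ↔ ∃ i, HasVar w i v)
    (hcard : V.card < w.length + 2) (hnest : HasNestPoints w V) :
    ∃ (τ : ℕ → ℕ) (h : IsOrder w V τ), countStmt.exec w (fun _ _ => 0) 0 0 =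
      totalWeight hV hcard h % 2 ^ (w.length + 2) := by
  obtain ⟨τ, hτ, h⟩ := exists_exec_orderStmt hV hnest hcard
  refine ⟨τ, h, ?_⟩
  have key : ∀ k ≤ w.length + 2, IsRound w (clauseSystem w hV hcard h) τ
      ((roundStmt.exec w)^[k] (initStmt.exec w (orderStmt.exec w fun _ _ => 0))) k := by
    intro k
    induction k with
    | zero => intro _; exact isRound_exec_initStmt hτ
    | succ k ih =>
      intro hk
      rw [Function.iterate_succ_apply']
      exact (ih (by omega)).exec (by omega)
  have := key _ le_rfl
  have hmod : ∀ x y : ℕ, x - x / y * y = x % y := fun x y => by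
    have := Nat.mod_add_div' x y
    omega
  change (Stmt.assign 0 (totalE - totalE / .bound 1 * .bound 1)).exec w
    ((roundStmt.exec w)^[w.length + 2] (initStmt.exec w (orderStmt.exec w fun _ _ => 0))) 0 0 = _
  refine exec_assign (Nat.succ_pos _) ?_ ?_
  · rw [eval_sub, eval_mul, eval_div, eval_bound, pow_one]
    rw [eval_totalE this, hmod]
  · refine (Nat.mod_lt _ (by positivity)).le.trans (Nat.pow_le_pow_right (by norm_num) ?_)
    exact Nat.le_self_pow (by norm_num) _

end RAM

/-! ### Satisfying assignments in terms of the clause system -/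

namespace SAT

open RAM Finset
open scoped Classical

theorem CNF.hasNestPoints {F : CNF} (hF : F.hypergraph.IsBetaAcyclic) :
    HasNestPoints F.encode F.vars := by
  intro τ ⟨v₀, hv₀, h₀⟩
  obtain ⟨xs, hxs⟩ := hF
  obtain ⟨v, ⟨hvV, hv0⟩, hv⟩ := hxs.exists_nest {u | u ∈ F.vars ∧ τ u = 0} (fun u hu => hu.1)
    ⟨v₀, hv₀, h₀⟩
  have hedge : ∀ i, HasVar F.encode i v → {u | HasVar F.encode i u} ∈ F.hypergraph.edgeSet := by
    intro i hi
    obtain ⟨p, hp, -⟩ := id hi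
    obtain ⟨C, hC, hiC⟩ := CNF.exists_clause hp.2.1 hp.2.2.1
    refine ⟨⟨v, hi⟩, C, hC, ?_⟩
    ext u
    exact hiC.hasVar_iff
  refine ⟨v, hvV, hv0, fun i j hi hj => ?_⟩
  refine (hv _ (hedge i hi) _ (hedge j hj) hi hj).imp ?_ ?_ <;>
    exact fun H u hu hiu => H ⟨hiu, CNF.mem_vars_iff.2 ⟨_, hiu⟩, hu⟩

section Order

variable {F : CNF} {τ : ℕ → ℕ} (hcard : F.vars.card < F.encode.length + 2)
  (h : IsOrder F.encode F.vars τ)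

/-- Equal times mean equal variables, and in a clause that is not a tautology all occurrences of a
variable have the same sign. -/
theorem posLevel_iff {F : CNF} {τ : ℕ → ℕ} (h : IsOrder F.encode F.vars τ) {i p : ℕ} (hi : IsProper F.encode i) (hp : InClause F.encode p i) :
    PosLevel F.encode τ i (τ (varAt F.encode p)) ↔ F.encode.getD p 0 % 2 = 1 := by
  refine ⟨fun ⟨q, hq, hqp, hq'⟩ => ?_, fun hp' => ⟨p, hp, rfl, hp'⟩⟩
  have := h.inj _ (CNF.mem_vars_iff.2 ⟨i, hq.hasVar⟩) _ (CNF.mem_vars_iff.2 ⟨i, hp.hasVar⟩) hqp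
  rwa [← hi.2.2 q p hq hp this]

/-- A clause is satisfied if it is a tautology or not falsified in the clause system. -/
theorem exists_literal_iff {i : ℕ} {C : Clause} (hC : HasClauseAt F.encode i C) (b : ℕ → Bool) :
    (∃ l ∈ C, b (τ l.var) = l.sign) ↔ (IsProper F.encode i →
      ¬ (clauseSystem F.encode (fun _ => CNF.mem_vars_iff) hcard h).Falsified 0 i b) := by
  constructor
  · rintro ⟨l, hl, hb⟩ hi hf
    obtain ⟨p, hp, hpl⟩ := (hC.2.2 _).2 ⟨l, hl, rfl⟩
    have hvar : varAt F.encode p = l.var := by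
      rw [varAt, hpl, Literal.encode_sub_one_div_two]
    have h₁ := hf (τ l.var) (Nat.zero_le _) ⟨p, hp, by rw [hvar]⟩
    have h₂ := posLevel_iff h hi hp
    rw [hpl, Literal.encode_mod_two, hvar] at h₂
    rw [hb] at h₁
    simp only [clauseSystem, h₂] at h₁
    cases hs : l.sign <;> simp [hs] at h₁
  · intro H
    by_cases hi : IsProper F.encode i
    · have := H hi
      simp only [ClauseSystem.Falsified, not_forall] at this
      obtain ⟨k, -, ⟨p, hp, rfl⟩, hb⟩ := this
      obtain ⟨l, hl, hpl⟩ := (hC.2.2 _).1 ⟨p, hp, rfl⟩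
      have hvar : varAt F.encode p = l.var := by
        rw [varAt, ← hpl, Literal.encode_sub_one_div_two]
      have h₂ := posLevel_iff h hi hp
      rw [← hpl, Literal.encode_mod_two] at h₂
      refine ⟨l, hl, ?_⟩
      rw [← hvar]
      simp only [clauseSystem, h₂] at hb
      cases hs : l.sign <;> simp [hs] at hb ⊢ <;> exact hb
    -- An improper clause contains a variable with both signs, and one of these two literals is true
    -- under any `b`.
    · have : ∃ p q, InClause F.encode p i ∧ InClause F.encode q i ∧
          varAt F.encode p = varAt F.encode q ∧ F.encode.getD p 0 ≠ F.encode.getD q 0 := by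
        by_contra hne
        push Not at hne
        exact hi ⟨hC.1, hC.2.1, hne⟩
      obtain ⟨p, q, hp, hq, hpq, hne⟩ := this
      obtain ⟨l, hl, hpl⟩ := (hC.2.2 _).1 ⟨p, hp, rfl⟩
      obtain ⟨l', hl', hql⟩ := (hC.2.2 _).1 ⟨q, hq, rfl⟩
      rw [varAt, varAt, ← hpl, ← hql, Literal.encode_sub_one_div_two,
        Literal.encode_sub_one_div_two] at hpq
      rw [← hpl, ← hql] at hne
      by_cases hb : b (τ l.var) = l.sign
      · exact ⟨l, hl, hb⟩
      · refine ⟨l', hl', ?_⟩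
        rw [← hpq]
        have : l.sign ≠ l'.sign := fun hs => hne (by
          obtain ⟨v, s⟩ := l
          obtain ⟨v', s'⟩ := l'
          simp only at hpq hs
          rw [hpq, hs])
        cases h₁ : b (τ l.var) <;> cases h₂ : l.sign <;> cases h₃ : l'.sign <;> simp_all

/-- The bijection sends an assignment to the set of elimination times of its true variables; `τ` is
injective on the variables, and the used levels are exactly its values there. -/
theorem CNF.numSat_eq : F.numSat = #{t ∈ {l ∈ range (F.encode.length + 2) |
      (clauseSystem F.encode (fun _ => CNF.mem_vars_iff) hcard h).Used l}.powerset |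
      ∀ j, IsProper F.encode j →
        ¬ (clauseSystem F.encode (fun _ => CNF.mem_vars_iff) hcard h).Falsified 0 j
          fun l => decide (l ∈ t)} := by
  have hmem : ∀ {l : ℕ}, l ∈ {l ∈ range (F.encode.length + 2) |
      (clauseSystem F.encode (fun _ => CNF.mem_vars_iff) hcard h).Used l} ↔
      ∃ v ∈ F.vars, τ v = l := by
    intro l
    rw [mem_filter, mem_range]
    constructor
    · rintro ⟨-, i, -, p, hp, rfl⟩
      exact ⟨_, CNF.mem_vars_iff.2 ⟨i, hp.hasVar⟩, rfl⟩
    · rintro ⟨v, hv, rfl⟩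
      obtain ⟨i, p, hp, rfl⟩ := CNF.mem_vars_iff.1 hv
      exact ⟨(h.le_card _).trans_lt hcard, i, hp.lt.2, p, hp, rfl⟩
  have hsat : ∀ (a : F.vars → Bool) (b : ℕ → Bool), (∀ v : F.vars, b (τ v) = a v) →
      (F.IsSatisfiedBy a ↔ ∀ j, IsProper F.encode j →
        ¬ (clauseSystem F.encode (fun _ => CNF.mem_vars_iff) hcard h).Falsified 0 j b) := by
    intro a b hab
    have hlit : ∀ C ∈ F, (∃ l ∈ C, ∃ h : l.var ∈ F.vars, a ⟨l.var, h⟩ = l.sign) ↔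
        ∃ l ∈ C, b (τ l.var) = l.sign := by
      intro C hC
      refine exists_congr fun l => and_congr_right fun hl => ?_
      have hv : l.var ∈ F.vars := Clause.vars_subset hC
        (List.mem_toFinset.2 (List.mem_map_of_mem hl))
      rw [hab ⟨l.var, hv⟩]
      exact ⟨fun ⟨_, h⟩ => h, fun h => ⟨hv, h⟩⟩
    constructor
    · intro H j hj
      obtain ⟨C, hC, hjC⟩ := CNF.exists_clause hj.1 hj.2.1
      exact (exists_literal_iff hcard h hjC b).1 ((hlit C hC).1 (H C hC)) hj
    · intro H C hC
      obtain ⟨i, hi⟩ := CNF.exists_hasClauseAt hC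
      exact (hlit C hC).2 ((exists_literal_iff hcard h hi b).2 (H i))
  have himg : ∀ (a : F.vars → Bool) (v : F.vars),
      τ v ∈ ({u : F.vars | a u = true} : Finset F.vars).image (fun u : F.vars => τ u) ↔
        a v = true := by
    intro a v
    simp only [mem_image, mem_filter, mem_univ, true_and]
    constructor
    · rintro ⟨u, hu, huv⟩
      rwa [← Subtype.ext (h.inj u u.2 v v.2 huv)]
    · exact fun hv => ⟨v, hv, rfl⟩
  rw [CNF.numSat, Nat.card_eq_fintype_card, Fintype.card_subtype]
  refine card_bij' (fun a _ => ({u : F.vars | a u = true} : Finset F.vars).image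
    (fun u : F.vars => τ u)) (fun t _ v => decide (τ v ∈ t)) ?_ ?_ ?_ ?_
  · intro a ha
    rw [mem_filter, mem_powerset]
    refine ⟨fun l hl => ?_, ?_⟩
    · obtain ⟨u, -, rfl⟩ := mem_image.1 hl
      exact hmem.2 ⟨u, u.2, rfl⟩
    · refine (hsat a _ fun v => ?_).1 (mem_filter.1 ha).2
      rw [Bool.eq_iff_iff, decide_eq_true_iff]
      exact himg a v
  · intro t ht
    rw [mem_filter]
    exact ⟨mem_univ _, (hsat _ _ fun v => rfl).2 (mem_filter.1 ht).2⟩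
  · intro a ha
    funext v
    rw [Bool.eq_iff_iff, decide_eq_true_iff]
    exact himg a v
  · intro t ht
    have htU := mem_powerset.1 (mem_filter.1 ht).1
    ext l
    simp only [mem_image, mem_filter, mem_univ, true_and, decide_eq_true_eq]
    constructor
    · rintro ⟨u, hu, rfl⟩
      exact hu
    · intro hl
      obtain ⟨v, hv, rfl⟩ := hmem.1 (htU hl)
      exact ⟨⟨v, hv⟩, hl, rfl⟩

end Order

end SAT

/-- On β-acyclic CNF formulas, the number of satisfying assignments can be computed in polynomial
time. -/
theorem mainTheorem2 :
    RAM.PolyTimeComputableOn SAT.CNF.encode {F : SAT.CNF | F.hypergraph.IsBetaAcyclic}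
      SAT.CNF.numSat := by
  refine RAM.polyTimeComputableOn_of_exec RAM.countStmt fun F hF => ?_
  have hcard : F.vars.card < F.encode.length + 2 := by
    have := F.card_vars_le
    omega
  obtain ⟨τ, h, hexec⟩ := RAM.exec_countStmt (fun _ => SAT.CNF.mem_vars_iff) hcard
    (SAT.CNF.hasNestPoints hF)
  rw [hexec, RAM.totalWeight_mod, SAT.CNF.numSat_eq hcard h]
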